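/- Let $d\ge 2$ and let $f_1,f_2$ be monic complex polynomials of degree $d$ which are post-critically finite (the set $\{f_i^n(c) : f_i'(c)=0,\ n\ge 1\}$ is finite). **Formal mating.** Let $\widetilde{\mathbb C}=\mathbb C\cup\{\infty\cdot e^{2i\pi\theta}:\theta\in\mathbb R/\mathbb Z\}$ be the plane compactified by a circle at infinity (homeomorphic to the closed disc), to which each $f_i$ extends by $\infty\cdot e^{2i\pi\theta}\mapsto\infty\cdot e^{2i\pi d\theta}$. Gluing two copies of $\widetilde{\mathbb C}$ along $\infty\cdot e^{2i\pi\theta}\sim\infty\cdot e^{-2i\pi\theta}$ gives a topological sphere $S$; its equator is the common circle at infinity. The formal mating $F=f_1\sqcup\!\sqcup f_2:S\to S$ is the map equal to (the extension of) $f_1$ on the first copy and of $f_2$ on the second. Let $P_F$ be its post-critical set, the set of all $F^n(c)$ with $n\ge 1$ and $c$ a critical point of $F$ (a point near which $F$ is not injective), and let $M=S\setminus P_F$. **Iterated monodromy group.** A map $p$ induces a partial self-covering of degree $d$ of a path connected, locally path connected space $M$ if $p^{-1}(M)\subseteq M$ and $p:p^{-1}(M)\to M$ is a covering of degree $d$.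 For $t\in M$, the tree of preimages $T(p,t)$ has as $n$-th level the set $p^{-n}(t)$ (points in different levels being distinguished), with edges $\{p(x),x\}$. The group $\pi_1(M,t)$ acts on $T(p,t)$ by tree automorphisms (level preserving graph automorphisms): for $x\in p^{-n}(t)$, $[\gamma]x$ is the endpoint of the $p^n$-lift of $\gamma$ starting at $x$. The iterated monodromy group $\mathrm{IMG}(p,t)$ is the image of $\pi_1(M,t)$ in $\mathrm{Aut}(T(p,t))$. A labeling choice $L$ at $t$ consists of a numbering $p^{-1}(t)=\{x_0,\dots,x_{d-1}\}$ and of paths $\ell_\varepsilon$ in $M$ from $t$ to $x_\varepsilon$. It labels the vertices of level $n$ by the words of length $n$ in the letters $0,\dots,d-1$: $x_\emptyset=t$, and $x_{\varepsilon w}$ is the endpoint of the $p^{|w|}$-lift of $\ell_\varepsilon$ from $x_w$. Through $L$, $\mathrm{IMG}(p,t)$ becomes the subgroup $\mathrm{IMG}^{L}(p,t)=\{(w\mapsto[\gamma]w):[\gamma]\in\pi_1(M,t)\}$, where $x_{[\gamma]w}=[\gamma]x_w$, of the automorphism group of the regular rooted tree $T_d$ of words (with edges $\{w,w\varepsilon\}$).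 **Proposition.** 1. $F$ induces a partial self-covering $F:S\setminus F^{-1}(P_F)\to S\setminus P_F$ of degree $d$. 2. For every base point $t\in S\setminus P_F$, the group $\mathrm{IMG}(F,t)$ contains a tree automorphism which, for every $n\ge 1$, acts on the $n$-th level of $T(F,t)$ as a cyclic permutation of order $d^n$ (the level has $d^n$ vertices, which are permuted in a single cycle). For every base point $t$ and every labeling choice $L$, the same holds for $\mathrm{IMG}^{L}(F,t)\subseteq\mathrm{Aut}(T_d)$ and the levels of $T_d$. 3. Let $t=\infty\cdot e^{2i\pi 0}$, which belongs to $S\setminus P_F$, and use the coordinate of the first copy on the equator. The loop $\gamma(s)=\infty\cdot e^{2i\pi s}$, $s\in[0,1]$, lies in $S\setminus P_F$. The points $x_\varepsilon=\infty\cdot e^{2i\pi\varepsilon/d}$ and the arcs $\ell_\varepsilon(s)=\infty\cdot e^{2i\pi s\varepsilon/d}$, $\varepsilon=0,\dots,d-1$, form a labeling choice $L$ at $t$. For it, $[\gamma]$ acts on words as the adding machine $g\in\mathrm{Aut}(T_d)$, given by $g(\emptyset)=\emptyset$, $g(\varepsilon w)=(\varepsilon+1)w$ for $\varepsilon<d-1$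 and $g((d-1)w)=0\,g(w)$. In particular $g\in\mathrm{IMG}^{L}(F,t)$. Both $g$ on the $n$-th level of $T_d$ and $[\gamma]$ on the $n$-th level of $T(F,t)$ are cyclic permutations of order $d^n$, for every $n\ge 1$. -/

import Mathlib

open Polynomial Topology unitInterval

noncomputable section

/-! ## Rooted trees and their automorphisms -/

/-- The group of tree automorphisms of a rooted tree with underlying graph `G`, where `lev v` is the
level of the vertex `v` (its distance to the root): the bijections of the vertices which preserve
the edges and the levels. -/
def treeAut {V : Type*} (G : SimpleGraph V) (lev : V → ℕ) : Subgroup (G ≃g G) where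
  carrier := {g | ∀ v, lev (g v) = lev v}
  one_mem' := fun _ => rfl
  mul_mem' := fun {a b} ha hb v => (ha (b v)).trans (hb v)
  inv_mem' := fun {a} ha v => by
    have h1 : a (a⁻¹ v) = v := RelIso.apply_inv_self a v
    have h2 := ha (a⁻¹ v)
    rw [h1] at h2
    exact h2.symm

/-- The regular rooted tree `T_d`: the vertices are the words in the letters `0, …, d - 1`, the
root is the empty word, and the edges are the pairs `{w, wε}` with `w` a word and `ε` a letter.
The level of a word is its length. -/
def regularTree (d : ℕ) : SimpleGraph (List (Fin d)) where
  Adj v w := (∃ ε, w = v ++ [ε]) ∨ (∃ ε, v = w ++ [ε])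
  symm := ⟨fun _ _ h => h.symm⟩
  loopless := ⟨fun v h => by rcases h with ⟨ε, h⟩ | ⟨ε, h⟩ <;> simp at h⟩

/-- `Aut(T_d)`. -/
abbrev RegularTreeAut (d : ℕ) : Type := treeAut (regularTree d) List.length

/-- `g` acts on the set `S` as a cyclic permutation of order `m`: the set `S` has exactly `m`
elements, and `g` permutes them in one single cycle. -/
def ActsAsCycle {V : Type*} (g : Equiv.Perm V) (S : Set V) (m : ℕ) : Prop :=
  S.Finite ∧ S.ncard = m ∧ g.IsCycleOn S

/-! ### The adding machine -/

/-- The adding machine on words: add one to the left-most digit, carrying to the right.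
Here `finRotate d` is the cyclic permutation `(0, 1, …, d - 1)`. -/
def addOne (d : ℕ) : List (Fin d) → List (Fin d)
  | [] => []
  | ε :: w => finRotate d ε :: if (ε : ℕ) + 1 = d then addOne d w else w

/-- The inverse of the adding machine on words. -/
def subOne (d : ℕ) : List (Fin d) → List (Fin d)
  | [] => []
  | ε :: w => (finRotate d).symm ε ::
      if (((finRotate d).symm ε : Fin d) : ℕ) + 1 = d then subOne d w else w

theorem subOne_addOne (d : ℕ) (w : List (Fin d)) : subOne d (addOne d w) = w := by
  induction w with
  | nil => rfl
  | cons ε w ih =>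
    by_cases h : (ε : ℕ) + 1 = d <;>
      simp only [addOne, subOne, Equiv.symm_apply_apply, h, if_true, if_false, ih]

theorem addOne_subOne (d : ℕ) (w : List (Fin d)) : addOne d (subOne d w) = w := by
  induction w with
  | nil => rfl
  | cons ε w ih =>
    by_cases h : (((finRotate d).symm ε : Fin d) : ℕ) + 1 = d <;>
      simp only [addOne, subOne, Equiv.apply_symm_apply, h, if_true, if_false, ih]

theorem length_addOne (d : ℕ) (w : List (Fin d)) : (addOne d w).length = w.length := by
  induction w with
  | nil => rfl
  | cons ε w ih => by_cases h : (ε : ℕ) + 1 = d <;> simp [addOne, h, ih]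

theorem addOne_append (d : ℕ) (w : List (Fin d)) (ε : Fin d) :
    ∃ δ, addOne d (w ++ [ε]) = addOne d w ++ [δ] := by
  induction w with
  | nil => exact ⟨finRotate d ε, by simp [addOne]⟩
  | cons η w ih =>
    obtain ⟨δ, hδ⟩ := ih
    by_cases h : (η : ℕ) + 1 = d
    · exact ⟨δ, by simp [addOne, h, hδ]⟩
    · exact ⟨ε, by simp [addOne, h]⟩

theorem subOne_append (d : ℕ) (w : List (Fin d)) (ε : Fin d) :
    ∃ δ, subOne d (w ++ [ε]) = subOne d w ++ [δ] := by
  induction w with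
  | nil => exact ⟨(finRotate d).symm ε, by simp [subOne]⟩
  | cons η w ih =>
    obtain ⟨δ, hδ⟩ := ih
    by_cases h : (((finRotate d).symm η : Fin d) : ℕ) + 1 = d
    · exact ⟨δ, by simp only [List.cons_append, subOne, h, if_true, hδ]⟩
    · exact ⟨ε, by simp only [List.cons_append, subOne, h, if_false]⟩

/-- The adding machine, as a tree automorphism of `T_d`. -/
def addingMachine (d : ℕ) : RegularTreeAut d :=
  ⟨{ toFun := addOne d
     invFun := subOne d
     left_inv := subOne_addOne d
     right_inv := addOne_subOne d
     map_rel_iff' := by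
      have fwd : ∀ v w : List (Fin d), (∃ ε, w = v ++ [ε]) → ∃ δ, addOne d w = addOne d v ++ [δ] := by
        rintro v w ⟨ε, rfl⟩
        exact addOne_append d v ε
      have bwd : ∀ v w : List (Fin d), (∃ ε, addOne d w = addOne d v ++ [ε]) →
          ∃ δ, w = v ++ [δ] := by
        rintro v w ⟨ε, h⟩
        obtain ⟨δ, hδ⟩ := subOne_append d (addOne d v) ε
        rw [← h, subOne_addOne, subOne_addOne] at hδ
        exact ⟨δ, hδ⟩
      intro v w
      exact ⟨Or.imp (bwd v w) (bwd w v), Or.imp (fwd v w) (fwd w v)⟩ },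
   length_addOne d⟩

/-! ## Partial self-coverings and the tree of preimages -/

section PartialSelfCovering

variable {X : Type*} [TopologicalSpace X]

/-- The map `f` induces a partial self-covering `f : f⁻¹(M) → M` of degree `d ≥ 2`: the space `M` is
path connected and locally path connected, `f⁻¹(M)` is contained in `M`, and `f : f⁻¹(M) → M` is a
covering all of whose fibres have `d` points. Its `n`-th iterate is `f^n : f⁻ⁿ(M) → M`. -/
structure IsPartialSelfCovering (f : X → X) (M : Set X) (d : ℕ) : Prop where
  two_le : 2 ≤ d
  pathConnected : PathConnectedSpace M
  locPathConnected : LocallyPathConnectedSpace M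
  preimage_subset : f ⁻¹' M ⊆ M
  covering : IsCoveringMap (M.restrictPreimage f)
  degree : ∀ y ∈ M, (f ⁻¹' {y}).Finite ∧ (f ⁻¹' {y}).ncard = d

/-- The set `f⁻ⁿ(t)`. -/
abbrev Fibre (f : X → X) (n : ℕ) (t : X) : Type _ := {x : X // f^[n] x = t}

/-- The vertices of the tree of preimages of `t`: the disjoint union of the sets `f⁻ⁿ(t)`. The
level of a vertex is its first component. -/
abbrev PreimageVertex (f : X → X) (t : X) : Type _ := Σ n : ℕ, Fibre f n t

/-- The tree of preimages `T(f, t)`: the edges are the pairs `{f(x), x}` where `f(x)` is in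
`f⁻ⁿ(t)` and `x` in `f⁻⁽ⁿ⁺¹⁾(t)`. -/
def preimageTree (f : X → X) (t : X) : SimpleGraph (PreimageVertex f t) where
  Adj v w := (w.1 = v.1 + 1 ∧ f w.2.1 = v.2.1) ∨ (v.1 = w.1 + 1 ∧ f v.2.1 = w.2.1)
  symm := ⟨fun _ _ h => h.symm⟩
  loopless := ⟨fun v h => by rcases h with ⟨h, -⟩ | ⟨h, -⟩ <;> omega⟩

/-- `Aut(T(f, t))`. -/
abbrev PreimageTreeAut (f : X → X) (t : X) : Type _ :=
  treeAut (preimageTree f t) (fun v => v.1)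

variable {f : X → X} {M : Set X} {d : ℕ}

/-- `Γ` is an `f^n`-lift of the path `γ`. (If `f` induces a partial self-covering of `M`, then every
path `Γ` in the ambient space with `f^n ∘ Γ = γ` is a path in `f⁻ⁿ(M) ⊆ M`.) -/
def IsLift (f : X → X) {M : Set X} (n : ℕ) {a b : M} (γ : Path a b) (Γ : C(I, M)) : Prop :=
  ∀ s, f^[n] (Γ s : X) = γ s

namespace IsPartialSelfCovering

theorem mem_of_iterate (h : IsPartialSelfCovering f M d) (n : ℕ) {x : X} (hx : f^[n] x ∈ M) :
    x ∈ M := by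
  induction n generalizing x with
  | zero => exact hx
  | succ n ih => exact h.preimage_subset (ih hx)

theorem exists_lift (h : IsPartialSelfCovering f M d) (n : ℕ) {a b : M} (γ : Path a b)
    (x : Fibre f n (a : X)) : ∃ Γ : C(I, M), (Γ 0 : X) = x ∧ IsLift f n γ Γ := by
  obtain ⟨x, hx⟩ := x
  induction n generalizing x with
  | zero => exact ⟨γ, by simpa using hx.symm, fun _ => rfl⟩
  | succ n ih =>
    obtain ⟨Γ', h0, hl⟩ := ih (f x) hx
    have hm : x ∈ f ⁻¹' M := by
      change f x ∈ M
      have h1 : (Γ' 0 : X) = f x := h0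
      rw [← h1]
      exact (Γ' 0).2
    have hb : Γ' 0 = M.restrictPreimage f ⟨x, hm⟩ := Subtype.ext h0
    let G := h.covering.liftPath Γ' ⟨x, hm⟩ hb
    have hG : ∀ s, M.restrictPreimage f (G s) = Γ' s :=
      fun s => congrFun (h.covering.liftPath_lifts Γ' ⟨x, hm⟩ hb) s
    refine ⟨⟨fun s => ⟨(G s : X), h.preimage_subset (G s).2⟩, by fun_prop⟩, ?_, fun s => ?_⟩
    · have := h.covering.liftPath_zero Γ' ⟨x, hm⟩ hb
      exact congrArg Subtype.val this
    · have h2 : f (G s : X) = Γ' s := congrArg Subtype.val (hG s)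
      change f^[n] (f (G s : X)) = _
      rw [h2]
      exact hl s

/-- Homotopy lifting: two `f^n`-lifts, with the same starting point, of homotopic paths
are homotopic. -/
theorem lift_homotopic (h : IsPartialSelfCovering f M d) (n : ℕ) {a b : M} {γ₀ γ₁ : Path a b}
    (H : γ₀.Homotopic γ₁) {Γ₀ Γ₁ : C(I, M)} (h0 : Γ₀ 0 = Γ₁ 0) (hl₀ : IsLift f n γ₀ Γ₀)
    (hl₁ : IsLift f n γ₁ Γ₁) : Γ₀.HomotopicRel Γ₁ {0, 1} := by
  induction n generalizing Γ₀ Γ₁ with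
  | zero =>
    have e0 : Γ₀ = γ₀.toContinuousMap := ContinuousMap.ext fun s => Subtype.ext (hl₀ s)
    have e1 : Γ₁ = γ₁.toContinuousMap := ContinuousMap.ext fun s => Subtype.ext (hl₁ s)
    rw [e0, e1]
    exact H
  | succ n ih =>
    have key : ∀ (γ : Path a b) (Γ : C(I, M)), IsLift f (n + 1) γ Γ → ∀ s, (Γ s : X) ∈ f ⁻¹' M := by
      intro γ Γ hl s
      apply h.mem_of_iterate n (x := f (Γ s))
      have : f^[n] (f (Γ s : X)) = γ s := hl s
      rw [this]
      exact (γ s).2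
    let G₀ : C(I, f ⁻¹' M) := ⟨fun s => ⟨Γ₀ s, key γ₀ Γ₀ hl₀ s⟩, by fun_prop⟩
    let G₁ : C(I, f ⁻¹' M) := ⟨fun s => ⟨Γ₁ s, key γ₁ Γ₁ hl₁ s⟩, by fun_prop⟩
    let p : C(f ⁻¹' M, M) := ⟨M.restrictPreimage f, h.covering.continuous⟩
    have hp : (p.comp G₀).HomotopicRel (p.comp G₁) {0, 1} := by
      refine ih ?_ (fun s => hl₀ s) (fun s => hl₁ s)
      apply Subtype.ext
      change f (Γ₀ 0 : X) = f (Γ₁ 0 : X)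
      rw [h0]
    have he : ∃ s ∈ ({0, 1} : Set I), G₀ s = G₁ s :=
      ⟨0, Or.inl rfl, Subtype.ext (congrArg (fun z : M => (z : X)) h0)⟩
    have hG : G₀.HomotopicRel G₁ {0, 1} := (h.covering.homotopicRel_iff_comp he).2 hp
    let ι : C(f ⁻¹' M, M) := ⟨fun x => ⟨x, h.preimage_subset x.2⟩, by fun_prop⟩
    exact hG.map fun K => K.compContinuousMap ι

theorem lift_endpoint_eq (h : IsPartialSelfCovering f M d) (n : ℕ) {a b : M} {γ₀ γ₁ : Path a b}
    (H : γ₀.Homotopic γ₁) {Γ₀ Γ₁ : C(I, M)} (h0 : (Γ₀ 0 : X) = Γ₁ 0) (hl₀ : IsLift f n γ₀ Γ₀)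
    (hl₁ : IsLift f n γ₁ Γ₁) : Γ₀ 1 = Γ₁ 1 := by
  obtain ⟨K⟩ := h.lift_homotopic n H (Subtype.ext h0) hl₀ hl₁
  rw [← K.eq_fst 0 (Or.inr rfl), ← K.eq_snd 0 (Or.inr rfl)]

/-- The `f^n`-lift of the path `γ` from the point `x` of `f⁻ⁿ(a)`. -/
def lift (h : IsPartialSelfCovering f M d) (n : ℕ) {a b : M} (γ : Path a b)
    (x : Fibre f n (a : X)) : C(I, M) :=
  (h.exists_lift n γ x).choose

theorem lift_zero (h : IsPartialSelfCovering f M d) (n : ℕ) {a b : M} (γ : Path a b)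
    (x : Fibre f n (a : X)) : (h.lift n γ x 0 : X) = x :=
  (h.exists_lift n γ x).choose_spec.1

theorem isLift_lift (h : IsPartialSelfCovering f M d) (n : ℕ) {a b : M} (γ : Path a b)
    (x : Fibre f n (a : X)) : IsLift f n γ (h.lift n γ x) :=
  (h.exists_lift n γ x).choose_spec.2

/-- The terminal point of the `f^n`-lift of the path `γ` from `x`. -/
def liftEnd (h : IsPartialSelfCovering f M d) (n : ℕ) {a b : M} (γ : Path a b)
    (x : Fibre f n (a : X)) : Fibre f n (b : X) :=
  ⟨h.lift n γ x 1, by rw [h.isLift_lift n γ x 1, γ.target]⟩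

theorem liftEnd_eq_of_homotopic (h : IsPartialSelfCovering f M d) (n : ℕ) {a b : M}
    {γ₀ γ₁ : Path a b} (H : γ₀.Homotopic γ₁) : h.liftEnd n γ₀ = h.liftEnd n γ₁ := by
  funext x
  apply Subtype.ext
  exact congrArg (fun z : M => (z : X)) (h.lift_endpoint_eq n H
    ((h.lift_zero n γ₀ x).trans (h.lift_zero n γ₁ x).symm)
    (h.isLift_lift n γ₀ x) (h.isLift_lift n γ₁ x))

theorem liftEnd_eq (h : IsPartialSelfCovering f M d) (n : ℕ) {a b : M} (γ : Path a b)
    (x : Fibre f n (a : X)) {Γ : C(I, M)} (h0 : (Γ 0 : X) = x) (hl : IsLift f n γ Γ) :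
    (h.liftEnd n γ x : X) = Γ 1 :=
  congrArg (fun z : M => (z : X)) (h.lift_endpoint_eq n (Path.Homotopic.refl γ)
    ((h.lift_zero n γ x).trans h0.symm) (h.isLift_lift n γ x) hl)

theorem liftEnd_refl (h : IsPartialSelfCovering f M d) (n : ℕ) (a : M) (x : Fibre f n (a : X)) :
    h.liftEnd n (Path.refl a) x = x := by
  apply Subtype.ext
  refine h.liftEnd_eq n _ x
    (Γ := ContinuousMap.const I ⟨x, h.mem_of_iterate n (by rw [x.2]; exact a.2)⟩) rfl fun s => ?_
  simpa using x.2

theorem liftEnd_trans (h : IsPartialSelfCovering f M d) (n : ℕ) {a b c : M} (γ : Path a b)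
    (δ : Path b c) (x : Fibre f n (a : X)) :
    h.liftEnd n (γ.trans δ) x = h.liftEnd n δ (h.liftEnd n γ x) := by
  apply Subtype.ext
  let P : Path (h.lift n γ x 0) (h.lift n γ x 1) := ⟨h.lift n γ x, rfl, rfl⟩
  let Q : Path (h.lift n γ x 1) (h.lift n δ (h.liftEnd n γ x) 1) :=
    ⟨h.lift n δ (h.liftEnd n γ x), Subtype.ext (h.lift_zero n δ _), rfl⟩
  have hP : ∀ s, f^[n] (P s : X) = γ s := h.isLift_lift n γ x
  have hQ : ∀ s, f^[n] (Q s : X) = δ s := h.isLift_lift n δ _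
  have h1 := h.liftEnd_eq n (γ.trans δ) x (Γ := (P.trans Q).toContinuousMap)
    (by
      change ((P.trans Q) 0 : X) = x
      rw [Path.source]
      exact h.lift_zero n γ x)
    (by
      intro s
      change f^[n] ((P.trans Q) s : X) = (γ.trans δ) s
      rw [Path.trans_apply, Path.trans_apply]
      split_ifs
      · exact hP _
      · exact hQ _)
  rw [h1]
  change ((P.trans Q) 1 : X) = _
  rw [Path.target]
  rfl

theorem apply_liftEnd_succ (h : IsPartialSelfCovering f M d) (n : ℕ) {a b : M} (γ : Path a b)
    (x : Fibre f (n + 1) (a : X)) :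
    f (h.liftEnd (n + 1) γ x : X) = h.liftEnd n γ ⟨f x, x.2⟩ := by
  have hl := h.isLift_lift (n + 1) γ x
  have key : ∀ s, (h.lift (n + 1) γ x s : X) ∈ f ⁻¹' M := by
    intro s
    apply h.mem_of_iterate n (x := f (h.lift (n + 1) γ x s))
    have : f^[n] (f (h.lift (n + 1) γ x s : X)) = γ s := hl s
    rw [this]
    exact (γ s).2
  let G : C(I, f ⁻¹' M) := ⟨fun s => ⟨h.lift (n + 1) γ x s, key s⟩, by fun_prop⟩
  let p : C(f ⁻¹' M, M) := ⟨M.restrictPreimage f, h.covering.continuous⟩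
  refine (h.liftEnd_eq n γ ⟨f x, x.2⟩ (Γ := p.comp G) ?_ fun s => hl s).symm
  change f (h.lift (n + 1) γ x 0 : X) = f x
  rw [h.lift_zero]

/-- The action of a homotopy class of paths from `a` to `b` on the points of `f⁻ⁿ(a)`:
`[γ] x` is the terminal point of the `f^n`-lift of `γ` from `x`. -/
def act (h : IsPartialSelfCovering f M d) (n : ℕ) {a b : M} (q : Path.Homotopic.Quotient a b) :
    Fibre f n (a : X) → Fibre f n (b : X) :=
  Quotient.lift (fun γ : Path a b => h.liftEnd n γ) (fun _ _ H => h.liftEnd_eq_of_homotopic n H) q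

theorem act_mk (h : IsPartialSelfCovering f M d) (n : ℕ) {a b : M} (γ : Path a b)
    (x : Fibre f n (a : X)) : h.act n (Path.Homotopic.Quotient.mk γ) x = h.liftEnd n γ x := rfl

theorem act_refl (h : IsPartialSelfCovering f M d) (n : ℕ) (a : M) (x : Fibre f n (a : X)) :
    h.act n (Path.Homotopic.Quotient.refl a) x = x := by
  rw [← Path.Homotopic.Quotient.mk_refl, act_mk, h.liftEnd_refl]

theorem act_trans (h : IsPartialSelfCovering f M d) (n : ℕ) {a b c : M}
    (p : Path.Homotopic.Quotient a b) (q : Path.Homotopic.Quotient b c) (x : Fibre f n (a : X)) :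
    h.act n (p.trans q) x = h.act n q (h.act n p x) := by
  obtain ⟨γ, rfl⟩ := Path.Homotopic.Quotient.mk_surjective p
  obtain ⟨δ, rfl⟩ := Path.Homotopic.Quotient.mk_surjective q
  rw [← Path.Homotopic.Quotient.mk_trans, act_mk, act_mk, act_mk, h.liftEnd_trans]

theorem apply_act_succ (h : IsPartialSelfCovering f M d) (n : ℕ) {a b : M}
    (q : Path.Homotopic.Quotient a b) (x : Fibre f (n + 1) (a : X)) :
    f (h.act (n + 1) q x : X) = h.act n q ⟨f x, x.2⟩ := by
  obtain ⟨γ, rfl⟩ := Path.Homotopic.Quotient.mk_surjective q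
  exact h.apply_liftEnd_succ n γ x

/-! ## The monodromy action and the iterated monodromy group -/

/-- The action of a class in the fundamental group on the vertices of the tree of preimages. -/
def actVertex (h : IsPartialSelfCovering f M d) (t : M) (q : FundamentalGroup M t)
    (v : PreimageVertex f (t : X)) : PreimageVertex f (t : X) :=
  ⟨v.1, h.act v.1 q.toPath v.2⟩

theorem actVertex_one (h : IsPartialSelfCovering f M d) (t : M) (v : PreimageVertex f (t : X)) :
    h.actVertex t 1 v = v := by
  obtain ⟨n, x⟩ := v
  exact congrArg (Sigma.mk n) (h.act_refl n t x)

theorem actVertex_mul (h : IsPartialSelfCovering f M d) (t : M) (p q : FundamentalGroup M t)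
    (v : PreimageVertex f (t : X)) :
    h.actVertex t (p * q) v = h.actVertex t p (h.actVertex t q v) := by
  obtain ⟨n, x⟩ := v
  exact congrArg (Sigma.mk n) (h.act_trans n q.toPath p.toPath x)

theorem actVertex_adj (h : IsPartialSelfCovering f M d) (t : M) (q : FundamentalGroup M t)
    {v w : PreimageVertex f (t : X)} (hvw : (preimageTree f (t : X)).Adj v w) :
    (preimageTree f (t : X)).Adj (h.actVertex t q v) (h.actVertex t q w) := by
  have key : ∀ v w : PreimageVertex f (t : X), (w.1 = v.1 + 1 ∧ f w.2.1 = v.2.1) →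
      ((h.actVertex t q w).1 = (h.actVertex t q v).1 + 1 ∧
        f (h.actVertex t q w).2.1 = (h.actVertex t q v).2.1) := by
    rintro ⟨n, x⟩ ⟨m, y⟩ ⟨h1, h2⟩
    dsimp only at h1 h2
    subst h1
    refine ⟨rfl, ?_⟩
    have h3 := h.apply_act_succ n q.toPath y
    have h4 : (⟨f y, y.2⟩ : Fibre f n (t : X)) = x := Subtype.ext h2
    rw [h4] at h3
    exact h3
  exact Or.imp (key v w) (key w v) hvw

/-- The monodromy action of the fundamental group `π₁(M, t)` by tree automorphisms on the tree of
preimages `T(f, t)`. (The products are the ones of Mathlib: in `π₁(M, t)` and in the group of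
tree automorphisms alike, the right-hand factor of a product comes first.) -/
def monodromy (h : IsPartialSelfCovering f M d) (t : M) :
    FundamentalGroup M t →* PreimageTreeAut f (t : X) where
  toFun q :=
    ⟨{ toFun := h.actVertex t q
       invFun := h.actVertex t q⁻¹
       left_inv := fun v => by rw [← h.actVertex_mul, inv_mul_cancel, h.actVertex_one]
       right_inv := fun v => by rw [← h.actVertex_mul, mul_inv_cancel, h.actVertex_one]
       map_rel_iff' := by
        intro v w
        refine ⟨fun H => ?_, h.actVertex_adj t q⟩
        have H' := h.actVertex_adj t q⁻¹ H
        simp only [Equiv.coe_fn_mk, ← h.actVertex_mul, inv_mul_cancel, h.actVertex_one] at H'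
        exact H' },
      fun _ => rfl⟩
  map_one' := Subtype.ext (RelIso.ext fun v => h.actVertex_one t v)
  map_mul' := fun p q => Subtype.ext (RelIso.ext fun v => h.actVertex_mul t p q v)

/-- The iterated monodromy group `IMG(f, t)`: the image of the monodromy action in `Aut(T(f, t))`,
that is the fundamental group `π₁(M, t)` modulo the kernel of the monodromy action. -/
def IMG (h : IsPartialSelfCovering f M d) (t : M) : Subgroup (PreimageTreeAut f (t : X)) :=
  (h.monodromy t).range

end IsPartialSelfCovering

/-! ### Labeling choices -/

/-- A labeling choice at the base point `t`: a numbering `x_0, …, x_{d-1}` of the preimages of `t`,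
and for every letter `ε` a path `ℓ_ε` in `M` from `t` to `x_ε`. -/
structure LabelingChoice (h : IsPartialSelfCovering f M d) (t : M) where
  /-- the numbering of the preimages -/
  pt : Fin d ≃ Fibre f 1 (t : X)
  /-- the paths -/
  path : ∀ ε : Fin d, Path t (⟨(pt ε : X),
    h.mem_of_iterate 1 (by rw [(pt ε).2]; exact t.2)⟩ : M)

namespace LabelingChoice

variable {h : IsPartialSelfCovering f M d} {t : M}

/-- The point `x_w` of `f⁻ⁿ(t)` labeled with the word `w` of length `n`: `x_∅ = t`, and `x_{εw}` is
the terminal point of the `f^n`-lift of `ℓ_ε` from `x_w`, where `n` is the length of `w`. -/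
def labelPt (L : LabelingChoice h t) : (w : List (Fin d)) → Fibre f w.length (t : X)
  | [] => ⟨t, rfl⟩
  | ε :: w => ⟨h.liftEnd w.length (L.path ε) (L.labelPt w), by
      change f^[w.length + 1] _ = _
      rw [Function.iterate_succ_apply', (h.liftEnd w.length (L.path ε) (L.labelPt w)).2]
      exact (L.pt ε).2⟩

/-- The vertex `x_w` of the tree of preimages labeled with the word `w`. -/
def label (L : LabelingChoice h t) (w : List (Fin d)) : PreimageVertex f (t : X) :=
  ⟨w.length, L.labelPt w⟩

/-- The tree automorphism `g` of `T_d` is the monodromy action `w ↦ [γ]w` of the class `q = [γ]` on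
the words, for the labeling choice `L`. It is determined by `x_{[γ]w} = [γ] x_w`. -/
def IsMonodromyOfClass (L : LabelingChoice h t) (q : FundamentalGroup M t) (g : RegularTreeAut d) :
    Prop :=
  ∀ w : List (Fin d), L.label (g.1 w) = (h.monodromy t q).1 (L.label w)

/-- The iterated monodromy group seen as a subgroup of `Aut(T_d)`, for the labeling
choice `L`. -/
def IMG (L : LabelingChoice h t) : Subgroup (RegularTreeAut d) where
  carrier := {g | ∃ q : FundamentalGroup M t, L.IsMonodromyOfClass q g}
  one_mem' := ⟨1, fun w => by rw [map_one]; rfl⟩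
  mul_mem' := by
    rintro a b ⟨p, hp⟩ ⟨q, hq⟩
    refine ⟨p * q, fun w => ?_⟩
    rw [map_mul]
    exact (hp (b.1 w)).trans (congrArg (h.monodromy t p).1 (hq w))
  inv_mem' := by
    rintro a ⟨p, hp⟩
    refine ⟨p⁻¹, fun w => ?_⟩
    have h1 := hp ((a⁻¹).1 w)
    have h2 : a.1 ((a⁻¹).1 w) = w := RelIso.apply_inv_self a.1 w
    rw [h2] at h1
    rw [map_inv, h1]
    exact (RelIso.inv_apply_self (h.monodromy t p).1 _).symm

end LabelingChoice

end PartialSelfCovering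

/-! ## Critical and post-critical points -/

/-- The critical points of a branched covering: the points near which it is not injective. -/
def criticalPoints {X : Type*} [TopologicalSpace X] (f : X → X) : Set X :=
  {x | ∀ U ∈ 𝓝 x, ¬ Set.InjOn f U}

/-- The post-critical set: the union of the forward images `f^n(c)`, `n ≥ 1`, of the
critical points. -/
def postcriticalSet {X : Type*} [TopologicalSpace X] (f : X → X) : Set X :=
  {y | ∃ c ∈ criticalPoints f, ∃ n : ℕ, 1 ≤ n ∧ f^[n] c = y}

/-- A complex polynomial is post-critically finite if the forward orbits of its (finite) critical
points form a finite set. -/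
def PostcriticallyFinite (p : ℂ[X]) : Prop :=
  {y : ℂ | ∃ c : ℂ, p.derivative.eval c = 0 ∧ ∃ n : ℕ, 1 ≤ n ∧ (fun z => p.eval z)^[n] c = y}.Finite

/-! ## The formal mating -/

/-- The complex plane, compactified by a circle at infinity: `inf θ` is the point
`∞ · exp (2 i π θ)`, with `θ` in `ℝ / ℤ`. -/
inductive CompactifiedPlane : Type
  | fin (z : ℂ) : CompactifiedPlane
  | inf (θ : UnitAddCircle) : CompactifiedPlane

namespace CompactifiedPlane

/-- The identification with the closed unit disc. -/
def toDisc : CompactifiedPlane → ℂ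
  | fin z => z / ((1 + ‖z‖ : ℝ) : ℂ)
  | inf θ => (AddCircle.toCircle θ : ℂ)

/-- The topology of the compactified plane, for which `toDisc` is a homeomorphism onto the closed
unit disc. -/
instance : TopologicalSpace CompactifiedPlane := TopologicalSpace.induced toDisc inferInstance

/-- The action of a monic polynomial `p` of degree `d`, extended to the circle at infinity by
`∞ · exp (2 i π θ) ↦ ∞ · exp (2 i π d θ)`. -/
def extend (d : ℕ) (p : ℂ[X]) : CompactifiedPlane → CompactifiedPlane
  | fin z => fin (p.eval z)
  | inf θ => inf (d • θ)

end CompactifiedPlane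

open CompactifiedPlane in
/-- The gluing of two compactified planes along their circles at infinity, in the opposite
direction. -/
inductive Glue : CompactifiedPlane ⊕ CompactifiedPlane → CompactifiedPlane ⊕ CompactifiedPlane → Prop
  | glue (θ : UnitAddCircle) : Glue (Sum.inl (inf θ)) (Sum.inr (inf (-θ)))

/-- The topological sphere obtained from two compactified planes by gluing, with the
quotient topology. -/
def MatingSphere : Type := Quot Glue

instance : TopologicalSpace MatingSphere := inferInstanceAs (TopologicalSpace (Quot Glue))

/-- The formal mating of two monic polynomials of degree `d`. -/
def formalMating (d : ℕ) (f₁ f₂ : ℂ[X]) : MatingSphere → MatingSphere :=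
  Quot.map (Sum.map (CompactifiedPlane.extend d f₁) (CompactifiedPlane.extend d f₂)) (by
    rintro _ _ ⟨θ⟩
    have h1 : d • (-θ) = -(d • θ) := smul_neg d θ
    simp only [Sum.map_inl, Sum.map_inr, CompactifiedPlane.extend, h1]
    exact Glue.glue (d • θ))

/-- The point `∞ · exp (2 i π θ)` of the equator, in the coordinate of the first plane. -/
def equator (θ : ℝ) : MatingSphere :=
  Quot.mk Glue (Sum.inl (CompactifiedPlane.inf (θ : UnitAddCircle)))

end

/-! ## Cyclic actions -/

/-! On the equator `F` is multiplication of the angle by `d`, and the critical points of `F` lie in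
the two open planes, which `F` preserves; so the equator misses `P_F`. The `F^n`-lift of the
equatorial loop from a point of angle `α` above `equator 0` is therefore explicit: it runs from `α`
to `α + 1/d^n` (`liftEnd_equator`). Level `n` of the tree above `equator 0` consists of the points
of angle `k/d^n`, and the loop sends each to the next, which is a single cycle of length `d^n`.
Conjugation by transport along a path carries this to every base point
(`exists_actsAsCycle_of_basePoint`). Every labeling choice is an isomorphism of trees (`labelIso`),
so the same holds in `Aut(T_d)`.

For the labeling by equatorial arcs, `ε₁…εₙ` labels the angle `(ε₁ + ε₂ d + … + εₙ d^(n-1))/d^n`.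
Its first letter is the least significant digit, so adding `1/d^n` is adding one with the carry
going to the right (`coe_wordAngle_addOne`).

The covering property is obtained by counting: a continuous self-map of a compact Hausdorff space
which, above an open set, is locally injective with fibres of `d` points is a covering there
(`isCoveringMapOn_of_ncard_fibre`). Above a plane point off `P_F` the polynomial equation has simple
roots only; above an equatorial point one solves `d • η = θ`. The analytic input is that in the
planes failure of local injectivity means a zero of the derivative (`fin_mem_criticalPoints_iff`),
and that at infinity the extended polynomials are continuous (`continuous_extend`) and locally
injective (`exists_injOn_extend`). -/

theorem ActsAsCycle.congr_equiv {V W : Type*} (e : V ≃ W) {g : Equiv.Perm V} {g' : Equiv.Perm W}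
    {S : Set V} {S' : Set W} {m : ℕ} (hS : ∀ v, e v ∈ S' ↔ v ∈ S) (hg : ∀ v, e (g v) = g' (e v))
    (H : ActsAsCycle g S m) : ActsAsCycle g' S' m := by
  obtain rfl : S' = e '' S := by
    ext w
    rw [e.image_eq_preimage_symm, Set.mem_preimage, ← hS, e.apply_symm_apply]
  obtain rfl : g' = e.permCongr g := by
    ext w
    rw [Equiv.permCongr_apply, hg, e.apply_symm_apply]
  obtain ⟨h1, h2, h3, h4⟩ := H
  refine ⟨h1.image e, by rw [Set.ncard_image_of_injective S e.injective, h2], ?_, ?_⟩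
  · refine ⟨?_, (e.permCongr g).injective.injOn, ?_⟩
    · rintro _ ⟨v, hv, rfl⟩
      exact ⟨g v, h3.mapsTo hv, hg v⟩
    · rintro _ ⟨v, hv, rfl⟩
      obtain ⟨u, hu, rfl⟩ := h3.surjOn hv
      exact ⟨e u, ⟨u, hu, rfl⟩, (hg u).symm⟩
  · rintro _ ⟨v, hv, rfl⟩ _ ⟨w, hw, rfl⟩
    obtain ⟨i, hi⟩ := h4 hv hw
    refine ⟨i, ?_⟩
    have h5 : (e.permCongr g) ^ i = e.permCongr (g ^ i) :=
      (map_zpow (Equiv.permCongrHom e) g i).symm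
    rw [h5, Equiv.permCongr_apply, e.symm_apply_apply, hi]

theorem finite_words_length (d n : ℕ) : {w : List (Fin d) | w.length = n}.Finite :=
  List.finite_length_eq (Fin d) n

theorem ncard_words_length (d n : ℕ) : {w : List (Fin d) | w.length = n}.ncard = d ^ n := by
  rw [← Nat.card_coe_set_eq]
  change Nat.card (List.Vector (Fin d) n) = d ^ n
  rw [Nat.card_eq_fintype_card, card_vector, Fintype.card_fin]

/-! ## Transport of the preimages along paths -/

theorem PreimageVertex.ext {X : Type*} {f : X → X} {t : X} {v w : PreimageVertex f t} (h1 : v.1 = w.1)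
    (h2 : (v.2 : X) = w.2) : v = w := by
  obtain ⟨n, x⟩ := v
  obtain ⟨m, y⟩ := w
  obtain rfl : n = m := h1
  exact congrArg (Sigma.mk n) (Subtype.ext h2)

section Monodromy

variable {X : Type*} [TopologicalSpace X] {f : X → X} {M : Set X} {d : ℕ}

namespace IsPartialSelfCovering

theorem liftEnd_symm_liftEnd (h : IsPartialSelfCovering f M d) (n : ℕ) {a b : M} (γ : Path a b)
    (x : Fibre f n (a : X)) : h.liftEnd n γ.symm (h.liftEnd n γ x) = x := by
  rw [← h.liftEnd_trans,
    ← h.liftEnd_eq_of_homotopic n (γ₀ := Path.refl a) ⟨Path.Homotopy.reflTransSymm γ⟩,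
    h.liftEnd_refl]

/-- The bijection between the preimages of `a` and those of `b` obtained by lifting a path from
`a` to `b`. -/
noncomputable def liftVertex (h : IsPartialSelfCovering f M d) {a b : M} (γ : Path a b) :
    PreimageVertex f (a : X) ≃ PreimageVertex f (b : X) where
  toFun v := ⟨v.1, h.liftEnd v.1 γ v.2⟩
  invFun v := ⟨v.1, h.liftEnd v.1 γ.symm v.2⟩
  left_inv v := by
    obtain ⟨n, x⟩ := v
    exact congrArg (Sigma.mk n) (h.liftEnd_symm_liftEnd n γ x)
  right_inv v := by
    obtain ⟨n, x⟩ := v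
    have := h.liftEnd_symm_liftEnd n γ.symm x
    rw [Path.symm_symm] at this
    exact congrArg (Sigma.mk n) this

theorem liftVertex_snd (h : IsPartialSelfCovering f M d) {a b : M} (γ : Path a b)
    (v : PreimageVertex f (a : X)) : (h.liftVertex γ v).2 = h.liftEnd v.1 γ v.2 := rfl

theorem liftVertex_trans (h : IsPartialSelfCovering f M d) {a b c : M} (γ : Path a b)
    (δ : Path b c) (v : PreimageVertex f (a : X)) :
    h.liftVertex (γ.trans δ) v = h.liftVertex δ (h.liftVertex γ v) := by
  obtain ⟨n, x⟩ := v
  exact congrArg (Sigma.mk n) (h.liftEnd_trans n γ δ x)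

theorem monodromy_mk_apply (h : IsPartialSelfCovering f M d) {t : M} (γ : Path t t)
    (v : PreimageVertex f (t : X)) :
    (h.monodromy t (FundamentalGroup.fromPath (Path.Homotopic.Quotient.mk γ))).1 v =
      h.liftVertex γ v := rfl

theorem apply_liftVertex (h : IsPartialSelfCovering f M d) {a b : M} (γ : Path a b)
    {v w : PreimageVertex f (a : X)} (h1 : w.1 = v.1 + 1) (h2 : f w.2 = v.2) :
    f (h.liftVertex γ w).2 = (h.liftVertex γ v).2 := by
  obtain ⟨n, x⟩ := v
  obtain ⟨m, y⟩ := w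
  dsimp only at h1 h2
  subst h1
  have h3 := h.apply_liftEnd_succ n γ y
  rw [show (⟨f y, y.2⟩ : Fibre f n (a : X)) = x from Subtype.ext h2] at h3
  exact h3

/-- A loop acting on each level of the tree of preimages as a cycle gives such loops at all
base points. -/
theorem exists_actsAsCycle_of_basePoint (h : IsPartialSelfCovering f M d) {t : M} (γ : Path t t)
    {m : ℕ → ℕ} (H : ∀ n, 1 ≤ n → ActsAsCycle (h.monodromy t
      (FundamentalGroup.fromPath (Path.Homotopic.Quotient.mk γ))).1.toEquiv {v | v.1 = n} (m n))
    (u : M) : ∃ q : FundamentalGroup M u, ∀ n, 1 ≤ n →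
      ActsAsCycle (h.monodromy u q).1.toEquiv {v | v.1 = n} (m n) := by
  have := h.pathConnected
  let δ : Path t u := PathConnectedSpace.somePath t u
  refine ⟨FundamentalGroup.fromPath (Path.Homotopic.Quotient.mk ((δ.symm.trans γ).trans δ)),
    fun n hn => (H n hn).congr_equiv (h.liftVertex δ) (fun v => Iff.rfl) fun v => ?_⟩
  change h.liftVertex δ (h.liftVertex γ v) =
    h.liftVertex ((δ.symm.trans γ).trans δ) (h.liftVertex δ v)
  rw [liftVertex_trans, liftVertex_trans]
  congr 2
  exact ((h.liftVertex δ).symm_apply_apply v).symm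

end IsPartialSelfCovering

/-! ## The tree of words and the tree of preimages -/

namespace LabelingChoice

variable {h : IsPartialSelfCovering f M d} {t : M}

theorem label_fst (L : LabelingChoice h t) (w : List (Fin d)) : (L.label w).1 = w.length := rfl

theorem label_cons_snd (L : LabelingChoice h t) (ε : Fin d) (w : List (Fin d)) :
    ((L.label (ε :: w)).2 : X) = (h.liftVertex (L.path ε) (L.label w)).2 := rfl

/-- The first letter is recovered from `f^n(x_{εw}) = x_ε`, where `n` is the length of `w`; undoing
the transport along `ℓ_ε` then leaves `x_w`, and induction applies. -/
theorem label_injective (L : LabelingChoice h t) : Function.Injective L.label := by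
  intro v
  induction v with
  | nil =>
    intro w hw
    exact (List.eq_nil_of_length_eq_zero (congrArg Sigma.fst hw).symm).symm
  | cons ε v ih =>
    rintro (_ | ⟨η, w⟩) hvw
    · exact absurd (congrArg Sigma.fst hvw) (Nat.succ_ne_zero _)
    have hl : v.length = w.length := Nat.succ_injective (congrArg Sigma.fst hvw)
    have hp : ((h.liftVertex (L.path ε) (L.label v)).2 : X) =
        (h.liftVertex (L.path η) (L.label w)).2 :=
      congrArg (fun z : PreimageVertex f (t : X) => (z.2 : X)) hvw
    have h1 : f^[v.length] ((h.liftVertex (L.path ε) (L.label v)).2 : X) = L.pt ε :=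
      (h.liftVertex (L.path ε) (L.label v)).2.2
    have h2 : f^[w.length] ((h.liftVertex (L.path η) (L.label w)).2 : X) = L.pt η :=
      (h.liftVertex (L.path η) (L.label w)).2.2
    obtain rfl : ε = η := by
      apply L.pt.injective
      apply Subtype.ext
      rw [← h1, ← h2, hp, hl]
    congr 1
    apply ih
    apply (h.liftVertex (L.path ε)).injective
    exact PreimageVertex.ext hl hp

/-- For `x` on level `n + 1` the point `f^n(x)` is some `x_ε`; transporting `x` backwards along
`ℓ_ε` gives a point of level `n`, labeled by induction. -/
theorem label_surjective (L : LabelingChoice h t) : Function.Surjective L.label := by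
  rintro ⟨n, x⟩
  induction n with
  | zero => exact ⟨[], PreimageVertex.ext rfl x.2.symm⟩
  | succ n ih =>
    obtain ⟨ε, hε⟩ := L.pt.surjective ⟨f^[n] x, by
      have := x.2
      rwa [Function.iterate_succ_apply'] at this⟩
    have hx : f^[n] (x : X) = L.pt ε := by rw [hε]
    let y := (h.liftVertex (L.path ε)).symm ⟨n, ⟨x, hx⟩⟩
    obtain ⟨w, hw⟩ := ih y.2
    have hy : h.liftVertex (L.path ε) (L.label w) = ⟨n, ⟨x, hx⟩⟩ := by
      rw [hw]
      exact (h.liftVertex (L.path ε)).apply_symm_apply ⟨n, ⟨x, hx⟩⟩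
    refine ⟨ε :: w, PreimageVertex.ext ?_ ?_⟩
    · exact congrArg (fun z => z.1 + 1) hy
    · rw [label_cons_snd, hy]

/-- Labels are built from the left but the tree grows on the right. The two agree because `f`
carries an `f^(n+1)`-lift of `ℓ_ε` to an `f^n`-lift of it. -/
theorem apply_label_append (L : LabelingChoice h t) (w : List (Fin d)) (η : Fin d) :
    f (L.label (w ++ [η])).2 = (L.label w).2 := by
  induction w with
  | nil =>
    have h1 : ((h.liftVertex (L.path η) (L.label [])).2 : X) = L.pt η :=
      (h.liftVertex (L.path η) (L.label [])).2.2
    rw [List.nil_append, label_cons_snd, h1]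
    exact (L.pt η).2
  | cons ε w ih =>
    rw [List.cons_append, label_cons_snd, label_cons_snd]
    exact h.apply_liftVertex (L.path ε) (by simp [label_fst]) ih

theorem exists_append_iff (L : LabelingChoice h t) (v w : List (Fin d)) :
    ((L.label w).1 = (L.label v).1 + 1 ∧ f (L.label w).2 = (L.label v).2) ↔
      ∃ ε, w = v ++ [ε] := by
  constructor
  · rintro ⟨h1, h2⟩
    rw [label_fst, label_fst] at h1
    obtain rfl | ⟨w', ε, rfl⟩ := List.eq_nil_or_concat' w
    · simp at h1
    · rw [L.apply_label_append] at h2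
      refine ⟨ε, congrArg (· ++ [ε]) (L.label_injective (PreimageVertex.ext ?_ h2))⟩
      simpa [label_fst] using h1
  · rintro ⟨ε, rfl⟩
    exact ⟨by simp [label_fst], L.apply_label_append v ε⟩

/-- The labeling of the preimages by the words is an isomorphism of trees. -/
noncomputable def labelIso (L : LabelingChoice h t) :
    regularTree d ≃g preimageTree f (t : X) where
  toEquiv := Equiv.ofBijective L.label ⟨L.label_injective, L.label_surjective⟩
  map_rel_iff' {v w} := or_congr (L.exists_append_iff v w) (L.exists_append_iff w v)

theorem label_labelIso_symm (L : LabelingChoice h t) (v : PreimageVertex f (t : X)) :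
    L.label (L.labelIso.symm v) = v := L.labelIso.apply_symm_apply v

theorem finite_level (L : LabelingChoice h t) (n : ℕ) :
    {v : PreimageVertex f (t : X) | v.1 = n}.Finite := by
  refine ((finite_words_length d n).image L.label).subset fun v hv => ?_
  obtain ⟨w, rfl⟩ := L.label_surjective v
  exact ⟨w, hv, rfl⟩

theorem ncard_level (L : LabelingChoice h t) (n : ℕ) :
    {v : PreimageVertex f (t : X) | v.1 = n}.ncard = d ^ n := by
  rw [← ncard_words_length d n, ← Set.ncard_image_of_injective _ L.label_injective]
  congr 1
  ext v
  constructor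
  · intro hv
    obtain ⟨w, rfl⟩ := L.label_surjective v
    exact ⟨w, hv, rfl⟩
  · rintro ⟨w, hw, rfl⟩
    exact hw

/-- The monodromy action of a class on the words. -/
noncomputable def monodromyOnWords (L : LabelingChoice h t) (q : FundamentalGroup M t) :
    RegularTreeAut d :=
  ⟨(L.labelIso.trans (h.monodromy t q).1).trans L.labelIso.symm, fun w => by
    change (L.label (L.labelIso.symm ((h.monodromy t q).1 (L.label w)))).1 = _
    rw [label_labelIso_symm]
    exact (h.monodromy t q).2 (L.label w)⟩

theorem isMonodromyOfClass_monodromyOnWords (L : LabelingChoice h t) (q : FundamentalGroup M t) :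
    L.IsMonodromyOfClass q (L.monodromyOnWords q) := fun _ => L.label_labelIso_symm _

theorem IsMonodromyOfClass.actsAsCycle_iff {L : LabelingChoice h t} {q : FundamentalGroup M t}
    {g : RegularTreeAut d} (H : L.IsMonodromyOfClass q g) {n m : ℕ} :
    ActsAsCycle g.1.toEquiv {w | w.length = n} m ↔
      ActsAsCycle (h.monodromy t q).1.toEquiv {v | v.1 = n} m := by
  refine ⟨fun hc => hc.congr_equiv L.labelIso.toEquiv (fun _ => Iff.rfl) H,
    fun hc => hc.congr_equiv L.labelIso.toEquiv.symm (fun v => ?_) fun v => ?_⟩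
  · change (L.label (L.labelIso.symm v)).1 = n ↔ v.1 = n
    rw [label_labelIso_symm]
  · apply L.labelIso.injective
    change L.label (L.labelIso.symm _) = L.label (g.1 (L.labelIso.symm v))
    rw [H, label_labelIso_symm, label_labelIso_symm]
    rfl

end LabelingChoice

end Monodromy

/-! ## Coverings from constant fibres -/

section Covering

open Set Filter

variable {X : Type*} [TopologicalSpace X] [T2Space X] [CompactSpace X] {f : X → X} {M : Set X}
  {d : ℕ}

/-- A continuous self-map of a compact Hausdorff space, which is locally injective above an open set
where its fibres have constant finite cardinality, is open at the points above that set. -/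
theorem image_mem_nhds_of_ncard_fibre (hf : Continuous f) (hM : IsOpen M)
    (hd : ∀ y ∈ M, (f ⁻¹' {y}).Finite ∧ (f ⁻¹' {y}).ncard = d)
    (hinj : ∀ x ∈ f ⁻¹' M, ∃ U ∈ 𝓝 x, InjOn f U) {x₀ : X} (hx₀ : f x₀ ∈ M) {W : Set X}
    (hW : W ∈ 𝓝 x₀) : f '' W ∈ 𝓝 (f x₀) := by
  classical
  obtain ⟨hfin, hcard⟩ := hd _ hx₀
  obtain ⟨V, hV, hdisj⟩ := hfin.t2_separation
  have hU : ∀ x ∈ f ⁻¹' {f x₀}, ∃ U ∈ 𝓝 x, InjOn f U := fun x hx =>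
    hinj x (by rw [mem_preimage, show f x = f x₀ from hx]; exact hx₀)
  choose! U hU hUinj using hU
  -- Around each point of the fibre take a set on which `f` is injective, shrunk into `W` at `x₀`
  -- only.
  let A : X → Set X := fun x => if x = x₀ then W ∩ U x else U x
  have hAU : ∀ x, A x ⊆ U x := by
    intro x
    by_cases h : x = x₀
    · simp only [A, h, if_true]
      exact inter_subset_right
    · simp only [A, h, if_false]
      exact subset_rfl
  have hA : ∀ x ∈ f ⁻¹' {f x₀}, A x ∈ 𝓝 x := by
    intro x hx
    by_cases h : x = x₀
    · simp only [A, h, if_true]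
      exact inter_mem hW (hU x₀ rfl)
    · simp only [A, h, if_false]
      exact hU x hx
  have hN : (⋃ x ∈ f ⁻¹' {f x₀}, A x) ∈ 𝓝ˢ (f ⁻¹' {f x₀}) := by
    rw [mem_nhdsSet_iff_forall]
    exact fun x hx => mem_of_superset (hA x hx) (subset_biUnion_of_mem (u := A) hx)
  -- Since `f` is closed, for `y` near `f x₀` the whole fibre above `y` lies in the union of the
  -- sets `A x`.
  obtain ⟨T, hT, hTA⟩ := isClosedMap_iff_comap_nhds_le.mp hf.isClosedMap hN
  filter_upwards [hT, hM.mem_nhds hx₀] with y hy hyM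
  have hidx : ∀ x ∈ f ⁻¹' {y}, ∃ k ∈ f ⁻¹' {f x₀}, x ∈ A k := by
    intro x hx
    have := hTA (show x ∈ f ⁻¹' T by rw [mem_preimage, show f x = y from hx]; exact hy)
    simpa only [mem_iUnion, exists_prop] using this
  choose! idx hidx hidxA using hidx
  -- Each `A k` contains at most one point above `y`. Both fibres have `d` points, so every `A k`
  -- contains one; for `k = x₀` it lies in `W`.
  have hidxinj : InjOn idx (f ⁻¹' {y}) := by
    intro a ha b hb hab
    refine hUinj (idx a) (hidx a ha) (hAU _ (hidxA a ha)) (hAU _ ?_)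
      ((show f a = y from ha).trans (show f b = y from hb).symm)
    rw [hab]
    exact hidxA b hb
  have himg : idx '' (f ⁻¹' {y}) = f ⁻¹' {f x₀} := by
    refine eq_of_subset_of_ncard_le (image_subset_iff.2 hidx) ?_ hfin
    rw [hidxinj.ncard_image, (hd y hyM).2, hcard]
  obtain ⟨x, hx, hxi⟩ : x₀ ∈ idx '' (f ⁻¹' {y}) := by
    rw [himg]
    rfl
  have hxA := hidxA x hx
  rw [hxi] at hxA
  simp only [A, if_true] at hxA
  exact ⟨x, hxA.1, hx⟩

/-- A continuous self-map of a compact Hausdorff space is a covering above every open set over which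
it is locally injective with fibres of constant finite cardinality. -/
theorem isCoveringMapOn_of_ncard_fibre (hf : Continuous f) (hM : IsOpen M)
    (hd : ∀ y ∈ M, (f ⁻¹' {y}).Finite ∧ (f ⁻¹' {y}).ncard = d)
    (hinj : ∀ x ∈ f ⁻¹' M, ∃ U ∈ 𝓝 x, InjOn f U) : IsCoveringMapOn f M := by
  refine IsCoveringMapOn.of_isLocalHomeomorphOn hf
    ((isLocalHomeomorphOn_iff_isOpenEmbedding_restrict _).2 fun x hx => ?_)
  obtain ⟨U, hU, hUinj⟩ := hinj x hx
  obtain ⟨O, hO, hOo, hxO⟩ := mem_nhds_iff.1 (inter_mem hU ((hM.preimage hf).mem_nhds hx))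
  refine ⟨O, hOo.mem_nhds hxO, .of_continuous_injective_isOpenMap
    (hf.comp continuous_subtype_val) ((hUinj.mono fun z hz => (hO hz).1).injective)
    (isOpenMap_iff_nhds_le.2 ?_)⟩
  rintro ⟨z, hz⟩
  intro S hS
  have h1 : (Subtype.val '' ((O.domRestrict f) ⁻¹' S)) ∈ 𝓝 z :=
    (hOo.isOpenEmbedding_subtypeVal.isOpenMap.image_mem_nhds (mem_map.1 hS))
  refine mem_of_superset
    (image_mem_nhds_of_ncard_fibre hf hM hd hinj (show f z ∈ M from (hO hz).2) h1) ?_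
  rintro _ ⟨_, ⟨v, hv, rfl⟩, rfl⟩
  exact hv

end Covering

/-! ## Local injectivity of polynomials -/

section Analysis

open Filter

/-- A polynomial which is injective near a point has a non-zero derivative there. -/
theorem Polynomial.derivative_eval_ne_zero_of_injOn {p : ℂ[X]} {c : ℂ} {U : Set ℂ} (hU : U ∈ 𝓝 c)
    (hinj : Set.InjOn (fun z => p.eval z) U) : p.derivative.eval c ≠ 0 := by
  intro hc
  -- Open mapping theorem: injectivity rules out that `p` is constant near `z`.
  have hnhds : ∀ z, U ∈ 𝓝 z → 𝓝 (p.eval z) ≤ Filter.map (fun z => p.eval z) (𝓝 z) := by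
    intro z hz
    have han : AnalyticAt ℂ (fun z => p.eval z) z :=
      p.differentiable.analyticAt z
    refine han.eventually_constant_or_nhds_le_map_nhds.resolve_left fun hconst => ?_
    have h1 : ∀ᶠ w in 𝓝[≠] z, False := by
      filter_upwards [nhdsWithin_le_nhds hconst, nhdsWithin_le_nhds hz, self_mem_nhdsWithin]
        with w hw hwU hne
      exact hne (hinj hwU (mem_of_mem_nhds hz) hw)
    exact h1.exists.elim fun _ h => h
  have hpd : p.derivative ≠ 0 := by
    intro h0
    have hC := derivative_eq_zero.1 h0
    have h1 : ∀ᶠ w in 𝓝[≠] c, False := by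
      filter_upwards [nhdsWithin_le_nhds hU, self_mem_nhdsWithin] with w hwU hne
      refine hne (hinj hwU (mem_of_mem_nhds hU) ?_)
      rw [eq_C_of_natDegree_eq_zero hC]
      simp
    exact h1.exists.elim fun _ h => h
  -- The local inverse `q` is continuous because `p` is open, and holomorphic near `p(c)` except
  -- possibly at `p(c)`, the zeros of `p'` being isolated. The singularity is removable, so the
  -- chain rule for `q ∘ p = id` at `c` reads `0 = 1`.
  let q : ℂ → ℂ := Function.invFunOn (fun z => p.eval z) U
  have hqp : ∀ z ∈ U, q (p.eval z) = z := fun z hz => hinj.leftInvOn_invFunOn hz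
  have hcont : ∀ z, U ∈ 𝓝 z → ContinuousAt q (p.eval z) := by
    intro z hz
    refine (tendsto_map'_iff.2 ?_ : Tendsto q (Filter.map (fun z => p.eval z) (𝓝 z)) _).mono_left
      (hnhds z hz)
    rw [hqp z (mem_of_mem_nhds hz)]
    exact tendsto_id.congr' (by filter_upwards [hz] with w hw using (hqp w hw).symm)
  have hroots : ∀ᶠ z in 𝓝 c, z ≠ c → p.derivative.eval z ≠ 0 := by
    have : ((p.derivative.rootSet ℂ) \ {c})ᶜ ∈ 𝓝 c :=
      ((p.derivative.rootSet_finite ℂ).subset Set.sdiff_subset).isClosed.isOpen_compl.mem_nhds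
        (by simp)
    filter_upwards [this] with z hz hne h0
    exact hz ⟨by rw [mem_rootSet]; exact ⟨hpd, by simpa using h0⟩, hne⟩
  have hdiff : ∀ᶠ y in 𝓝[≠] (p.eval c), DifferentiableAt ℂ q y := by
    rw [eventually_nhdsWithin_iff]
    refine (hnhds c hU) (eventually_map.2 ?_)
    filter_upwards [hroots, eventually_mem_nhds_iff.2 hU] with z hz hzU hne
    have hzc : z ≠ c := fun h => hne (by rw [h]; rfl)
    refine (HasDerivAt.of_local_left_inverse (f := fun z => p.eval z)
      (f' := p.derivative.eval z) (hcont z hzU) ?_ (hz hzc) ?_).differentiableAt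
    · rw [hqp z (mem_of_mem_nhds hzU)]
      exact p.hasDerivAt z
    · refine (hnhds z hzU) (eventually_map.2 ?_)
      filter_upwards [hzU] with w hw
      rw [hqp w hw]
  have han := Complex.analyticAt_of_differentiable_on_punctured_nhds_of_continuousAt hdiff
    (hcont c hU)
  have h1 := han.differentiableAt.hasDerivAt.comp c (p.hasDerivAt c)
  rw [hc, mul_zero] at h1
  have h2 : HasDerivAt (q ∘ fun z => p.eval z) 1 c :=
    (hasDerivAt_id c).congr_of_eventuallyEq (by filter_upwards [hU] with w hw using hqp w hw)
  exact zero_ne_one (h1.unique h2)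

theorem Polynomial.exists_injOn_of_derivative_eval_ne_zero {p : ℂ[X]} {c : ℂ}
    (hc : p.derivative.eval c ≠ 0) : ∃ U ∈ 𝓝 c, Set.InjOn (fun z => p.eval z) U := by
  have h1 := (p.hasStrictDerivAt c).hasStrictFDerivAt_equiv hc
  exact ⟨_, h1.toOpenPartialHomeomorph _ |>.open_source.mem_nhds
    h1.mem_toOpenPartialHomeomorph_source, (h1.toOpenPartialHomeomorph _).injOn⟩

/-- If the derivative has positive real part, up to a constant factor, on a convex set, then the
function is injective there. -/
theorem Convex.injOn_of_re_deriv_pos {s : Set ℂ} (hs : Convex ℝ s) {f f' : ℂ → ℂ} (k : ℂ)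
    (hf : ∀ z ∈ s, HasDerivAt f (f' z) z) (hpos : ∀ z ∈ s, 0 < (f' z * k).re) : Set.InjOn f s := by
  intro a ha b hb hab
  by_contra hne
  have hne' : b - a ≠ 0 := sub_ne_zero.2 (Ne.symm hne)
  -- Dividing by `b - a` cancels the direction of the segment, so the derivative of `φ` is the real
  -- part assumed positive, against Rolle's theorem.
  let φ : ℝ → ℝ := fun x => (f (AffineMap.lineMap a b x) * (k / (b - a))).re
  have hmem : ∀ x ∈ Set.Icc (0 : ℝ) 1, (AffineMap.lineMap a b x : ℂ) ∈ s := fun x hx =>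
    hs.segment_subset ha hb (by rw [segment_eq_image_lineMap]; exact ⟨x, hx, rfl⟩)
  have hφ : ∀ x ∈ Set.Icc (0 : ℝ) 1,
      HasDerivAt φ ((f' (AffineMap.lineMap a b x) * k).re) x := by
    intro x hx
    have h1 : HasDerivAt (fun x : ℝ => f (AffineMap.lineMap a b x))
        (f' (AffineMap.lineMap a b x) * (b - a)) x :=
      (hf _ (hmem x hx)).comp_of_eq x AffineMap.hasDerivAt_lineMap rfl
    have h2 := (Complex.reCLM.hasFDerivAt.comp_hasDerivAt x (h1.mul_const (k / (b - a))))
    have h3 : f' (AffineMap.lineMap a b x) * (b - a) * (k / (b - a)) =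
        f' (AffineMap.lineMap a b x) * k := by field_simp
    rw [h3] at h2
    exact h2
  obtain ⟨x, hx, h0⟩ := exists_hasDerivAt_eq_zero (f := φ) zero_lt_one
    (fun x hx => (hφ x hx).continuousAt.continuousWithinAt)
    (by simp only [φ, AffineMap.lineMap_apply_zero, AffineMap.lineMap_apply_one, hab])
    fun x hx => hφ x (Set.Ioo_subset_Icc_self hx)
  exact (hpos _ (hmem x (Set.Ioo_subset_Icc_self hx))).ne' h0

/-! ### Polynomials near the circle at infinity. -/

/-- The quotient is the reversed polynomial evaluated at `1/z`, and the constant term of that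
polynomial is the leading coefficient of `p`. -/
theorem Polynomial.tendsto_eval_div_pow_natDegree (p : ℂ[X]) {α : Type*} {l : Filter α} {z : α → ℂ}
    (hz : Tendsto (fun a => ‖z a‖) l atTop) :
    Tendsto (fun a => p.eval (z a) / z a ^ p.natDegree) l (𝓝 p.leadingCoeff) := by
  have h0 : Tendsto (fun a => (z a)⁻¹) l (𝓝 0) :=
    tendsto_inv₀_cobounded.comp (tendsto_norm_atTop_iff_cobounded.1 hz)
  have h1 : Tendsto (fun a => p.reverse.eval (z a)⁻¹) l (𝓝 (p.reverse.eval 0)) :=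
    (p.reverse.continuous.tendsto 0).comp h0
  rw [← coeff_zero_eq_eval_zero, coeff_zero_reverse] at h1
  refine h1.congr' ?_
  filter_upwards [hz.eventually_gt_atTop 0] with a ha
  have hne : z a ≠ 0 := norm_pos_iff.1 ha
  have := invertibleOfNonzero hne
  have h2 := eval₂_reverse_mul_pow (RingHom.id ℂ) (z a) p
  rw [eq_div_iff (pow_ne_zero _ hne)]
  simpa [eval₂_eq_eval_map] using h2

/-- The filter of the points `z` of the plane which tend to the point at infinity in the direction
of `e`. -/
noncomputable def nhdsInfinity (e : ℂ) : Filter ℂ := comap (fun z : ℂ => z / ((1 + ‖z‖ : ℝ) : ℂ)) (𝓝 e)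

theorem tendsto_disc_nhdsInfinity (e : ℂ) :
    Tendsto (fun z : ℂ => z / ((1 + ‖z‖ : ℝ) : ℂ)) (nhdsInfinity e) (𝓝 e) := tendsto_comap

theorem norm_disc (z : ℂ) : ‖z / ((1 + ‖z‖ : ℝ) : ℂ)‖ = 1 - (1 + ‖z‖)⁻¹ := by
  have : (0 : ℝ) < 1 + ‖z‖ := by positivity
  rw [norm_div, Complex.norm_real, Real.norm_of_nonneg this.le]
  field_simp
  ring

variable {e : ℂ}

/-- The disc coordinate of `z` has modulus `1 - 1/(1 + ‖z‖)`, which tends to `‖e‖ = 1`. -/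
theorem tendsto_one_add_norm_nhdsInfinity (he : ‖e‖ = 1) :
    Tendsto (fun z : ℂ => 1 + ‖z‖) (nhdsInfinity e) atTop := by
  have h1 : Tendsto (fun z : ℂ => (1 + ‖z‖)⁻¹) (nhdsInfinity e) (𝓝[>] 0) := by
    refine tendsto_nhdsWithin_iff.2 ⟨?_, Eventually.of_forall fun z => ?_⟩
    · have h2 := (tendsto_disc_nhdsInfinity e).norm.const_sub 1
      rw [he, sub_self] at h2
      refine h2.congr fun z => ?_
      rw [norm_disc, sub_sub_cancel]
    · exact inv_pos.2 (show (0 : ℝ) < 1 + ‖z‖ by positivity)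
  exact ((tendsto_inv_nhdsGT_zero (𝕜 := ℝ)).comp h1).congr fun z => inv_inv _

theorem tendsto_norm_nhdsInfinity (he : ‖e‖ = 1) :
    Tendsto (fun z : ℂ => ‖z‖) (nhdsInfinity e) atTop :=
  (tendsto_atTop_add_const_left _ (-1) (tendsto_one_add_norm_nhdsInfinity he)).congr
    fun z => by ring

/-- A monic polynomial of degree `d` extends continuously to the circle at infinity, as the `d`-th
power. -/
theorem Polynomial.Monic.tendsto_eval_nhdsInfinity {p : ℂ[X]} (hp : p.Monic) (hd : p.natDegree ≠ 0)
    (he : ‖e‖ = 1) : Tendsto (fun z : ℂ => p.eval z / ((1 + ‖p.eval z‖ : ℝ) : ℂ))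
      (nhdsInfinity e) (𝓝 (e ^ p.natDegree)) := by
  have hN := tendsto_one_add_norm_nhdsInfinity he
  have h1 := p.tendsto_eval_div_pow_natDegree (tendsto_norm_nhdsInfinity he)
  rw [hp.leadingCoeff] at h1
  -- Numerator and denominator are both normalised by `(1 + ‖z‖)^deg p`: the former tends to `e^deg
  -- p`, the latter to `‖e‖^deg p = 1`.
  have h2 : Tendsto (fun z : ℂ => p.eval z / ((1 + ‖z‖ : ℝ) : ℂ) ^ p.natDegree) (nhdsInfinity e)
      (𝓝 (e ^ p.natDegree)) := by
    have h3 := h1.mul ((tendsto_disc_nhdsInfinity e).pow p.natDegree)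
    rw [one_mul] at h3
    refine h3.congr' ?_
    filter_upwards [(tendsto_norm_nhdsInfinity he).eventually_gt_atTop 0] with z hz
    have hne : z ^ p.natDegree ≠ 0 := pow_ne_zero _ (norm_pos_iff.1 hz)
    rw [div_pow, div_mul_div_cancel₀ hne]
  have h3 : Tendsto (fun z : ℂ => (1 + ‖p.eval z‖) / (1 + ‖z‖) ^ p.natDegree) (nhdsInfinity e)
      (𝓝 1) := by
    have h4 := ((tendsto_inv_atTop_zero (𝕜 := ℝ)).comp ((tendsto_pow_atTop hd).comp hN)).add h2.norm
    rw [norm_pow, he, one_pow, zero_add] at h4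
    refine h4.congr fun z => ?_
    have : (0 : ℝ) < 1 + ‖z‖ := by positivity
    rw [norm_div, norm_pow, Complex.norm_real, Real.norm_of_nonneg this.le]
    simp only [Function.comp_apply]
    rw [add_div, one_div]
  have h5 := h2.div ((Complex.continuous_ofReal.tendsto _).comp h3)
    (by rw [Complex.ofReal_one]; exact one_ne_zero)
  rw [Complex.ofReal_one, div_one] at h5
  refine h5.congr fun z => ?_
  have : ((1 + ‖z‖ : ℝ) : ℂ) ^ p.natDegree ≠ 0 :=
    pow_ne_zero _ (Complex.ofReal_ne_zero.2 (by positivity))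
  simp only [Pi.div_apply, Function.comp_apply]
  rw [Complex.ofReal_div, Complex.ofReal_pow, div_div_div_cancel_right₀ this]

/-- A non-constant monic polynomial is injective near infinity, in a given direction. -/
theorem Polynomial.Monic.exists_injOn_nhdsInfinity {p : ℂ[X]} (hp : p.Monic)
    (hd : p.natDegree ≠ 0) (he : ‖e‖ = 1) :
    ∃ U ∈ nhdsInfinity e, Set.InjOn (fun z => p.eval z) U := by
  let k : ℂ := (starRingEnd ℂ) e
  have hek : e * k = 1 := by
    rw [Complex.mul_conj, Complex.normSq_eq_norm_sq, he]
    norm_num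
  -- Multiplication by `k` turns the direction `e` into the positive real axis. The filter `L` has a
  -- basis of truncated sectors around that direction, which are convex, as the derivative criterion
  -- for injectivity requires.
  let L : Filter ℂ := comap (fun z => (z * k).re) atTop ⊓
    comap (fun z => (z * k).im / (z * k).re) (𝓝 0)
  have hre : Tendsto (fun z => (z * k).re) L atTop := tendsto_comap.mono_left inf_le_left
  have him : Tendsto (fun z => (z * k).im / (z * k).re) L (𝓝 0) :=
    tendsto_comap.mono_left inf_le_right
  have hk : ‖k‖ = 1 := by rw [RCLike.norm_conj, he]
  have hnorm : Tendsto (fun z : ℂ => ‖z‖) L atTop := by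
    refine tendsto_atTop_mono (fun z => ?_) hre
    calc (z * k).re ≤ ‖z * k‖ := Complex.re_le_norm _
      _ = ‖z‖ := by rw [norm_mul, hk, mul_one]
  have hquot : Tendsto (fun z : ℂ => z * k / ((z * k).re : ℂ)) L (𝓝 1) := by
    have h1 := ((Complex.continuous_ofReal.tendsto _).comp him).mul_const Complex.I |>.const_add 1
    rw [Complex.ofReal_zero, zero_mul, add_zero] at h1
    refine h1.congr' ?_
    filter_upwards [hre.eventually_gt_atTop 0] with z hz
    have hz' : ((z * k).re : ℂ) ≠ 0 := Complex.ofReal_ne_zero.2 hz.ne'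
    simp only [Function.comp_apply]
    rw [eq_div_iff hz', Complex.ofReal_div]
    conv_rhs => rw [← Complex.re_add_im (z * k)]
    field_simp
  set n := p.derivative.natDegree with hn
  -- In a thin sector `p'(z)` is close to `(deg p) z^n`, and `k^n` cancels its nearly constant
  -- argument.
  have hpos : ∀ᶠ z in L, 0 < (p.derivative.eval z * k ^ n).re := by
    have h1 := (p.derivative.tendsto_eval_div_pow_natDegree hnorm).mul (hquot.pow n)
    have h2 : p.derivative.leadingCoeff = p.natDegree := by
      rw [leadingCoeff_derivative, hp.leadingCoeff, one_mul]
    rw [h2, one_pow, mul_one] at h1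
    have h3 := (Complex.continuous_re.tendsto _).comp h1
    rw [Complex.natCast_re] at h3
    filter_upwards [hre.eventually_gt_atTop 0, hnorm.eventually_gt_atTop 0,
      h3.eventually_const_lt (Nat.cast_pos.2 (Nat.pos_of_ne_zero hd))] with z hz hz0 hlt
    have hne : z ^ n ≠ 0 := pow_ne_zero _ (norm_pos_iff.1 hz0)
    simp only [Function.comp_apply] at hlt
    rw [div_pow, mul_pow, ← hn, div_mul_div_comm, mul_left_comm, mul_div_mul_left _ _ hne,
      ← Complex.ofReal_pow, Complex.div_ofReal_re] at hlt
    exact (div_pos_iff_of_pos_right (pow_pos hz n)).1 hlt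
  have hle : nhdsInfinity e ≤ L := by
    have hu : Tendsto (fun z : ℂ => z / ((1 + ‖z‖ : ℝ) : ℂ) * k) (nhdsInfinity e) (𝓝 1) := by
      have := (tendsto_disc_nhdsInfinity e).mul_const k
      rwa [hek] at this
    have hur := (Complex.continuous_re.tendsto _).comp hu
    have hui := (Complex.continuous_im.tendsto _).comp hu
    have hzr : ∀ z : ℂ, (z * k).re = (1 + ‖z‖) * (z / ((1 + ‖z‖ : ℝ) : ℂ) * k).re := by
      intro z
      have : (1 + ‖z‖ : ℝ) ≠ 0 := by positivity
      rw [div_mul_eq_mul_div, Complex.div_ofReal_re, mul_div_cancel₀ _ this]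
    have hzi : ∀ z : ℂ, (z * k).im = (1 + ‖z‖) * (z / ((1 + ‖z‖ : ℝ) : ℂ) * k).im := by
      intro z
      have : (1 + ‖z‖ : ℝ) ≠ 0 := by positivity
      rw [div_mul_eq_mul_div, Complex.div_ofReal_im, mul_div_cancel₀ _ this]
    refine le_inf (tendsto_iff_comap.1 ?_) (tendsto_iff_comap.1 ?_)
    · exact ((tendsto_one_add_norm_nhdsInfinity he).atTop_mul_pos zero_lt_one hur).congr
        fun z => (hzr z).symm
    · have h1 := hui.div hur one_ne_zero
      rw [Complex.one_im, zero_div] at h1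
      refine h1.congr fun z => ?_
      have : (1 + ‖z‖ : ℝ) ≠ 0 := by positivity
      rw [hzr, hzi, mul_div_mul_left _ _ this]
      rfl
  have hbasis := ((atTop_basis_Ioi' (0 : ℝ)).comap (fun z : ℂ => (z * k).re)).inf
    ((Metric.nhds_basis_ball (x := (0 : ℝ))).comap (fun z : ℂ => (z * k).im / (z * k).re))
  obtain ⟨⟨R, ε⟩, ⟨hR, hε⟩, hsub⟩ := hbasis.mem_iff.1 hpos
  refine ⟨_, hle (hbasis.mem_of_mem (i := (R, ε)) ⟨hR, hε⟩), ?_⟩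
  refine Convex.injOn_of_re_deriv_pos ?_ (k ^ n) (fun z _ => p.hasDerivAt z) fun z hz => hsub hz
  -- As `(z * k).re > R > 0`, the bound on the slope becomes two linear inequalities, so the sector
  -- is an intersection of half-planes.
  have hset : (fun z : ℂ => (z * k).re) ⁻¹' Set.Ioi R ∩
      (fun z : ℂ => (z * k).im / (z * k).re) ⁻¹' Metric.ball 0 ε =
      {z | R < (z * k).re ∧ (z * k).im < ε * (z * k).re ∧ -(ε * (z * k).re) < (z * k).im} := by
    ext z
    refine and_congr_right fun hz => ?_
    have hz0 : 0 < (z * k).re := lt_trans hR hz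
    rw [Set.mem_preimage, mem_ball_zero_iff, Real.norm_eq_abs, abs_lt, lt_div_iff₀ hz0,
      div_lt_iff₀ hz0, neg_mul, and_comm]
  change Convex ℝ ((fun z : ℂ => (z * k).re) ⁻¹' Set.Ioi R ∩
      (fun z : ℂ => (z * k).im / (z * k).re) ⁻¹' Metric.ball 0 ε)
  rw [hset]
  let r : ℂ →ₗ[ℝ] ℝ := Complex.reLm ∘ₗ LinearMap.mulRight ℝ k
  let i : ℂ →ₗ[ℝ] ℝ := Complex.imLm ∘ₗ LinearMap.mulRight ℝ k
  have h1 : Convex ℝ {z | R < r z} := convex_halfSpace_gt r.isLinear R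
  have h2 : Convex ℝ {z | (i - ε • r) z < 0} := convex_halfSpace_lt (i - ε • r).isLinear 0
  have h3 : Convex ℝ {z | 0 < (i + ε • r) z} := convex_halfSpace_gt (i + ε • r).isLinear 0
  convert h1.inter (h2.inter h3) using 1
  ext z
  refine and_congr Iff.rfl (and_congr ?_ ?_)
  · exact sub_neg.symm
  · exact neg_lt_iff_pos_add

end Analysis

/-! ## The compactified plane -/

namespace CompactifiedPlane

open Filter

theorem toDisc_fin (z : ℂ) : toDisc (fin z) = z / ((1 + ‖z‖ : ℝ) : ℂ) := rfl

theorem toDisc_inf (θ : UnitAddCircle) : toDisc (inf θ) = (AddCircle.toCircle θ : ℂ) := rfl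

theorem norm_toDisc_fin (z : ℂ) : ‖toDisc (fin z)‖ = 1 - (1 + ‖z‖)⁻¹ := norm_disc z

theorem norm_toDisc_inf (θ : UnitAddCircle) : ‖toDisc (inf θ)‖ = 1 := Circle.norm_coe _

theorem norm_toDisc_fin_lt (z : ℂ) : ‖toDisc (fin z)‖ < 1 := by
  rw [norm_toDisc_fin, sub_lt_self_iff, inv_pos]
  positivity

theorem norm_toDisc_le (x : CompactifiedPlane) : ‖toDisc x‖ ≤ 1 := by
  cases x with
  | fin z => exact (norm_toDisc_fin_lt z).le
  | inf θ => exact (norm_toDisc_inf θ).le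

/-- The modulus of the image determines `‖z‖`, hence `z`, and equals one only on the circle. -/
theorem toDisc_injective : Function.Injective toDisc := by
  rintro (z | θ) (w | η) h
  · have h1 := congrArg norm h
    rw [norm_toDisc_fin, norm_toDisc_fin, sub_right_inj, inv_inj, add_right_inj] at h1
    rw [toDisc_fin, toDisc_fin, h1] at h
    have h2 : ((1 + ‖w‖ : ℝ) : ℂ) ≠ 0 := Complex.ofReal_ne_zero.2 (by positivity)
    rw [(div_left_inj' h2).1 h]
  · exact absurd (congrArg norm h) (by rw [norm_toDisc_inf]; exact (norm_toDisc_fin_lt z).ne)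
  · exact absurd (congrArg norm h) (by rw [norm_toDisc_inf]; exact (norm_toDisc_fin_lt w).ne')
  · rw [AddCircle.injective_toCircle one_ne_zero (Circle.coe_injective h)]

theorem toDisc_fin_div (u : ℂ) (hu : ‖u‖ < 1) : toDisc (fin (u / ((1 - ‖u‖ : ℝ) : ℂ))) = u := by
  have h1 : 0 < 1 - ‖u‖ := sub_pos.2 hu
  have h2 : ((1 - ‖u‖ : ℝ) : ℂ) ≠ 0 := Complex.ofReal_ne_zero.2 h1.ne'
  rw [toDisc_fin, norm_div, Complex.norm_real, Real.norm_of_nonneg h1.le]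
  have h3 : 1 + ‖u‖ / (1 - ‖u‖) = (1 - ‖u‖)⁻¹ := by field_simp; ring
  rw [h3, Complex.ofReal_inv, div_inv_eq_mul, div_mul_cancel₀ _ h2]

theorem range_toDisc : Set.range toDisc = Metric.closedBall 0 1 := by
  ext u
  rw [mem_closedBall_zero_iff]
  constructor
  · rintro ⟨x, rfl⟩
    exact norm_toDisc_le x
  · intro hu
    rcases hu.lt_or_eq with h | h
    · exact ⟨_, toDisc_fin_div u h⟩
    · obtain ⟨θ, hθ⟩ := (AddCircle.homeomorphCircle (T := 1) one_ne_zero).surjective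
        ⟨u, mem_sphere_zero_iff_norm.2 h⟩
      refine ⟨inf θ, ?_⟩
      rw [AddCircle.homeomorphCircle_apply] at hθ
      rw [toDisc_inf, hθ]

theorem isInducing_toDisc : IsInducing toDisc := ⟨rfl⟩

theorem isEmbedding_toDisc : IsEmbedding toDisc := ⟨isInducing_toDisc, toDisc_injective⟩

instance : CompactSpace CompactifiedPlane := by
  rw [← isCompact_univ_iff, isInducing_toDisc.isCompact_iff, Set.image_univ, range_toDisc]
  exact isCompact_closedBall 0 1

instance : LocallyPathConnectedSpace CompactifiedPlane := by
  have h1 : LocallyPathConnectedSpace (Set.range toDisc) := by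
    rw [range_toDisc]
    exact (convex_closedBall (0 : ℂ) 1).locallyPathConnectedSpace
  exact isEmbedding_toDisc.toHomeomorph.isOpenEmbedding.locallyPathConnectedSpace

theorem isPathConnected_preimage_toDisc {C : Set ℂ} (hC : C ⊆ Metric.closedBall 0 1)
    (h : IsPathConnected C) : IsPathConnected (toDisc ⁻¹' C) := by
  rw [isInducing_toDisc.isPathConnected_iff, Set.image_preimage_eq_of_subset]
  · exact h
  · rwa [range_toDisc]

theorem continuous_inf : Continuous inf :=
  isInducing_toDisc.continuous_iff.2 (continuous_subtype_val.comp AddCircle.continuous_toCircle)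

/-- The map `u ↦ u / (1 - ‖u‖)` is a continuous inverse on the open unit disc. -/
theorem isOpenEmbedding_fin : IsOpenEmbedding fin := by
  refine ⟨⟨⟨?_⟩, fun _ _ h => by injection h⟩, ?_⟩
  · refine (isInducing_iff_nhds.2 fun z => le_antisymm ?_ ?_).eq_induced
    · refine Tendsto.le_comap (Continuous.tendsto (isInducing_toDisc.continuous_iff.2 ?_) z)
      exact continuous_id.div (by fun_prop) fun w => Complex.ofReal_ne_zero.2 (by positivity)
    · let g : ℂ → ℂ := fun u => u / ((1 - ‖u‖ : ℝ) : ℂ)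
      have hg : ∀ w, g (toDisc (fin w)) = w := fun w => by
        have := toDisc_injective (toDisc_fin_div _ (norm_toDisc_fin_lt w))
        injection this
      have hc : ContinuousAt g (toDisc (fin z)) :=
        continuousAt_id.div (by fun_prop)
          (Complex.ofReal_ne_zero.2 (sub_pos.2 (norm_toDisc_fin_lt z)).ne')
      rw [isInducing_toDisc.nhds_eq_comap, comap_comap]
      have h1 := hc.tendsto.comp
        (tendsto_comap : Tendsto (toDisc ∘ fin) (comap (toDisc ∘ fin) (𝓝 (toDisc (fin z)))) _)
      rw [hg] at h1
      exact h1.congr hg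
  · have : Set.range fin = toDisc ⁻¹' Metric.ball 0 1 := by
      ext x
      rw [Set.mem_preimage, mem_ball_zero_iff]
      cases x with
      | fin z => exact iff_of_true ⟨z, rfl⟩ (norm_toDisc_fin_lt z)
      | inf θ => exact iff_of_false (by rintro ⟨z, hz⟩; cases hz) (norm_toDisc_inf θ).not_lt
    rw [this]
    exact Metric.isOpen_ball.preimage isInducing_toDisc.continuous

theorem tendsto_of_fin_of_inf {α : Type*} {g : CompactifiedPlane → α} {l : Filter CompactifiedPlane}
    {m : Filter α} (h1 : Tendsto (fun z => g (fin z)) (comap fin l) m)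
    (h2 : Tendsto (fun θ => g (inf θ)) (comap inf l) m) : Tendsto g l m := by
  intro S hS
  rw [mem_map]
  obtain ⟨t₁, ht₁, hs₁⟩ := h1 hS
  obtain ⟨t₂, ht₂, hs₂⟩ := h2 hS
  filter_upwards [ht₁, ht₂] with x hx₁ hx₂
  cases x with
  | fin z => exact hs₁ hx₁
  | inf θ => exact hs₂ hx₂

theorem toCircle_nsmul (n : ℕ) (θ : UnitAddCircle) :
    (AddCircle.toCircle (n • θ) : ℂ) = (AddCircle.toCircle θ : ℂ) ^ n := by
  rw [AddCircle.toCircle_nsmul, Circle.coe_pow]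

variable {d : ℕ} {p : ℂ[X]}

theorem continuous_extend (hp : p.Monic) (hd : p.natDegree = d) (hd0 : d ≠ 0) :
    Continuous (extend d p) := by
  rw [continuous_iff_continuousAt]
  rintro (z | θ)
  · rw [← isOpenEmbedding_fin.continuousAt_iff]
    exact (isOpenEmbedding_fin.continuous.comp p.continuous).continuousAt
  · rw [isInducing_toDisc.continuousAt_iff, ContinuousAt, isInducing_toDisc.nhds_eq_comap]
    have hlim : (toDisc ∘ extend d p) (inf θ) = toDisc (inf θ) ^ p.natDegree := by
      rw [hd]
      exact toCircle_nsmul d θ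
    rw [hlim]
    refine tendsto_of_fin_of_inf ?_ ?_
    · rw [comap_comap]
      exact hp.tendsto_eval_nhdsInfinity (hd ▸ hd0) (norm_toDisc_inf θ)
    · rw [comap_comap, hd]
      refine (((continuous_pow d).tendsto _).comp tendsto_comap).congr fun η => ?_
      exact (toCircle_nsmul d η).symm

/-- The extension of a monic polynomial is injective near each point at infinity. -/
theorem exists_injOn_extend (hp : p.Monic) (hd : p.natDegree = d) (hd0 : d ≠ 0)
    (θ : UnitAddCircle) :
    ∃ T ∈ 𝓝 (AddCircle.toCircle θ : ℂ), Set.InjOn (extend d p) (toDisc ⁻¹' T) := by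
  obtain ⟨U, ⟨T₁, hT₁, hU⟩, hinj⟩ := hp.exists_injOn_nhdsInfinity (hd ▸ hd0)
    (Circle.norm_coe (AddCircle.toCircle θ))
  -- On the circle the extension is the `d`-th power map, whose derivative does not vanish there.
  -- Plane and circle are each preserved, so two separate injectivity statements suffice.
  obtain ⟨T₂, hT₂, hinj₂⟩ := (X ^ d : ℂ[X]).exists_injOn_of_derivative_eval_ne_zero
    (c := (AddCircle.toCircle θ : ℂ)) (by simp [derivative_X_pow, hd0])
  refine ⟨T₁ ∩ T₂, inter_mem hT₁ hT₂, ?_⟩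
  rintro (z | η) hz (w | ζ) hw h
  · have h1 : p.eval z = p.eval w := by injection h
    rw [hinj (hU hz.1) (hU hw.1) h1]
  · cases h
  · cases h
  · have h1 : d • η = d • ζ := by injection h
    apply toDisc_injective
    refine hinj₂ hz.2 hw.2 ?_
    simp only [eval_pow, eval_X]
    rw [toDisc_inf, toDisc_inf, ← toCircle_nsmul, h1, toCircle_nsmul]

end CompactifiedPlane

/-! ## The mating sphere -/

namespace MatingSphere

open CompactifiedPlane

/-- The two halves of the mating sphere; `true` stands for the first one. -/
def half (b : Bool) (x : CompactifiedPlane) : MatingSphere :=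
  Quot.mk Glue (bif b then Sum.inl x else Sum.inr x)

theorem half_false_inf (θ : UnitAddCircle) : half false (inf θ) = half true (inf (-θ)) := by
  have := Quot.sound (Glue.glue (-θ))
  rw [neg_neg] at this
  exact this.symm

theorem exists_half (s : MatingSphere) : ∃ b x, half b x = s := by
  obtain ⟨x | x⟩ := s
  · exact ⟨true, x, rfl⟩
  · exact ⟨false, x, rfl⟩

theorem eq_fin_or_inf (s : MatingSphere) :
    (∃ b z, s = half b (fin z)) ∨ ∃ θ, s = half true (inf θ) := by
  obtain ⟨b, z | θ, rfl⟩ := exists_half s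
  · exact .inl ⟨b, z, rfl⟩
  · cases b
    · exact .inr ⟨-θ, half_false_inf θ⟩
    · exact .inr ⟨θ, rfl⟩

theorem continuous_half (b : Bool) : Continuous (half b) := by
  cases b
  · exact continuous_quot_mk.comp continuous_inr
  · exact continuous_quot_mk.comp continuous_inl

/-- The mating sphere as a sphere in the space `ℂ × ℝ`. -/
noncomputable def toSpace : MatingSphere → ℂ × ℝ :=
  Quot.lift (Sum.elim (fun x => (toDisc x, 1 - ‖toDisc x‖))
    (fun x => (starRingEnd ℂ (toDisc x), -(1 - ‖toDisc x‖)))) (by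
    rintro _ _ ⟨θ⟩
    simp only [Sum.elim_inl, Sum.elim_inr, norm_toDisc_inf, sub_self, neg_zero]
    rw [toDisc_inf, toDisc_inf, AddCircle.toCircle_neg, Circle.coe_inv_eq_conj,
      Complex.conj_conj])

theorem toSpace_half_true (x : CompactifiedPlane) :
    toSpace (half true x) = (toDisc x, 1 - ‖toDisc x‖) := rfl

theorem toSpace_half_false (x : CompactifiedPlane) :
    toSpace (half false x) = (starRingEnd ℂ (toDisc x), -(1 - ‖toDisc x‖)) := rfl

theorem continuous_toSpace : Continuous toSpace := by
  have h := isInducing_toDisc.continuous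
  refine continuous_quot_lift _ (Continuous.sumElim ?_ ?_)
  · fun_prop
  · exact (Complex.continuous_conj.comp h).prodMk (by fun_prop)

/-- The height is nonnegative on the first half and nonpositive on the second, and vanishes only at
infinity. There the conjugation in the second half matches the gluing `θ ∼ -θ`. -/
theorem toSpace_injective : Function.Injective toSpace := by
  have key : ∀ x y, toSpace (half true x) = toSpace (half false y) →
      half true x = half false y := by
    intro x y h
    rw [toSpace_half_true, toSpace_half_false, Prod.mk.injEq] at h
    obtain ⟨h1, h2⟩ := h
    have h3 := norm_toDisc_le x
    have h4 := norm_toDisc_le y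
    rcases x with z | θ
    · have := norm_toDisc_fin_lt z
      linarith
    rcases y with w | η
    · have := norm_toDisc_fin_lt w
      linarith
    rw [half_false_inf]
    congr 1
    apply toDisc_injective
    rw [h1, toDisc_inf, toDisc_inf, AddCircle.toCircle_neg, Circle.coe_inv_eq_conj]
  intro s t h
  obtain ⟨b, x, rfl⟩ := exists_half s
  obtain ⟨c, y, rfl⟩ := exists_half t
  cases b <;> cases c
  · rw [toSpace_half_false, toSpace_half_false, Prod.mk.injEq] at h
    rw [toDisc_injective ((starRingEnd ℂ).injective h.1)]
  · exact (key y x h.symm).symm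
  · exact key x y h
  · rw [toSpace_half_true, toSpace_half_true, Prod.mk.injEq] at h
    rw [toDisc_injective h.1]

instance : T2Space MatingSphere := .of_injective_continuous toSpace_injective continuous_toSpace

instance : CompactSpace MatingSphere := inferInstanceAs (CompactSpace (Quot Glue))

instance : LocallyPathConnectedSpace MatingSphere :=
  inferInstanceAs (LocallyPathConnectedSpace (Quot Glue))

theorem half_injective (b : Bool) : Function.Injective (half b) := by
  intro x y h
  have := congrArg toSpace h
  cases b
  · rw [toSpace_half_false, toSpace_half_false, Prod.mk.injEq] at this
    exact toDisc_injective ((starRingEnd ℂ).injective this.1)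
  · rw [toSpace_half_true, toSpace_half_true, Prod.mk.injEq] at this
    exact toDisc_injective this.1

theorem half_fin_ne_half {b c : Bool} (hbc : b ≠ c) (z : ℂ) (x : CompactifiedPlane) :
    half b (fin z) ≠ half c x := by
  intro h
  have h1 := congrArg Prod.snd (congrArg toSpace h)
  have h2 := norm_toDisc_fin_lt z
  have h3 := norm_toDisc_le x
  cases b <;> cases c
  · exact hbc rfl
  · rw [toSpace_half_false, toSpace_half_true] at h1
    dsimp only at h1
    linarith
  · rw [toSpace_half_false, toSpace_half_true] at h1
    dsimp only at h1
    linarith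
  · exact hbc rfl

theorem half_fin_ne_inf (b : Bool) (z : ℂ) (θ : UnitAddCircle) :
    half b (fin z) ≠ half true (inf θ) := by
  cases b
  · exact half_fin_ne_half (by decide) z _
  · intro h
    cases half_injective true h

theorem half_fin_eq_iff {b c : Bool} {z w : ℂ} :
    half b (fin z) = half c (fin w) ↔ b = c ∧ z = w := by
  refine ⟨fun h => ?_, fun h => by rw [h.1, h.2]⟩
  by_cases hbc : b = c
  · subst hbc
    exact ⟨rfl, by injection half_injective b h⟩
  · exact absurd h (half_fin_ne_half hbc z _)

/-- Plane points are not glued to anything, so an open set of one plane has empty trace on the other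
copy and is open in the quotient. -/
theorem isOpenEmbedding_half_fin (b : Bool) : IsOpenEmbedding fun z => half b (fin z) := by
  refine .of_continuous_injective_isOpenMap
    ((continuous_half b).comp isOpenEmbedding_fin.continuous)
    (fun z w h => (half_fin_eq_iff.1 h).2) fun V hV => ?_
  have hV' := isOpenEmbedding_fin.isOpenMap V hV
  have key : ∀ c, IsOpen (half c ⁻¹' ((fun z => half b (fin z)) '' V)) := by
    intro c
    by_cases hbc : b = c
    · subst hbc
      rw [show (fun z => half b (fin z)) '' V = half b '' (fin '' V) from
        (Set.image_image (half b) fin V).symm, Set.preimage_image_eq _ (half_injective b)]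
      exact hV'
    · rw [Set.eq_empty_of_forall_notMem (s := half c ⁻¹' _)]
      · exact isOpen_empty
      · rintro x ⟨z, -, h⟩
        exact half_fin_ne_half hbc z x h
  exact isOpen_coinduced.2 (isOpen_sum_iff.2 ⟨key true, key false⟩)

end MatingSphere

/-! ## Fibres of polynomials -/

/-- A multiple root of `p - w` would be a zero of `p'` above `w`; hence the `deg p` complex roots
are distinct. -/
theorem Polynomial.ncard_fibre_of_derivative_ne_zero {p : ℂ[X]} (hd : p.natDegree ≠ 0) (w : ℂ)
    (h : ∀ z, p.eval z = w → p.derivative.eval z ≠ 0) :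
    {z | p.eval z = w}.Finite ∧ {z | p.eval z = w}.ncard = p.natDegree := by
  have hdeg : (p - C w).natDegree = p.natDegree := natDegree_sub_C
  have h0 : p - C w ≠ 0 := fun h0 => hd (by rw [← hdeg, h0, natDegree_zero])
  have hset : {z | p.eval z = w} = ((p - C w).roots.toFinset : Set ℂ) := by
    ext z
    simp [h0, sub_eq_zero]
  have hnodup : (p - C w).roots.Nodup := by
    rw [Multiset.nodup_iff_count_le_one]
    intro z
    rw [count_roots]
    by_contra hz
    rw [not_le, one_lt_rootMultiplicity_iff_isRoot h0] at hz
    obtain ⟨hz1, hz2⟩ := hz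
    refine h z ?_ (by simpa using hz2)
    simpa [sub_eq_zero] using hz1
  rw [hset]
  refine ⟨Finset.finite_toSet _, ?_⟩
  rw [Set.ncard_coe_finset, Multiset.toFinset_card_of_nodup hnodup, ← hdeg]
  exact (splits_iff_card_roots.1 (IsAlgClosed.splits _))

/-- On the unit circle this is `z^d = w`, whose complex solutions are simple and automatically of
modulus one. -/
theorem ncard_nsmul_eq {d : ℕ} (hd : d ≠ 0) (θ : UnitAddCircle) :
    {η : UnitAddCircle | d • η = θ}.Finite ∧ {η : UnitAddCircle | d • η = θ}.ncard = d := by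
  have h1 := (X ^ d : ℂ[X]).ncard_fibre_of_derivative_ne_zero (by simpa using hd)
    (AddCircle.toCircle θ : ℂ) (fun z hz => by
      rw [eval_pow, eval_X] at hz
      have hz0 : z ≠ 0 := by
        rintro rfl
        rw [zero_pow hd] at hz
        exact Circle.coe_ne_zero _ hz.symm
      simp [derivative_X_pow, hd, hz0])
  have hinj : Function.Injective fun η : UnitAddCircle => (AddCircle.toCircle η : ℂ) :=
    Circle.coe_injective.comp (AddCircle.injective_toCircle one_ne_zero)
  have himg : (fun η : UnitAddCircle => (AddCircle.toCircle η : ℂ)) '' {η | d • η = θ} =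
      {z | (X ^ d : ℂ[X]).eval z = AddCircle.toCircle θ} := by
    ext z
    simp only [eval_pow, eval_X]
    constructor
    · rintro ⟨η, rfl, rfl⟩
      exact (CompactifiedPlane.toCircle_nsmul d η).symm
    · intro hz
      replace hz : z ^ d = AddCircle.toCircle θ := hz
      have hn : ‖z‖ = 1 := by
        have := congrArg norm hz
        rw [norm_pow, Circle.norm_coe] at this
        exact (pow_eq_one_iff_of_nonneg (norm_nonneg z) hd).1 this
      obtain ⟨η, hη⟩ := (AddCircle.homeomorphCircle (T := 1) one_ne_zero).surjective
        ⟨z, mem_sphere_zero_iff_norm.2 hn⟩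
      rw [AddCircle.homeomorphCircle_apply] at hη
      have hη' : (AddCircle.toCircle η : ℂ) = z := by rw [hη]
      refine ⟨η, hinj ?_, hη'⟩
      change (AddCircle.toCircle (d • η) : ℂ) = AddCircle.toCircle θ
      rw [CompactifiedPlane.toCircle_nsmul, hη', hz]
  rw [natDegree_X_pow, ← himg, Set.finite_image_iff hinj.injOn, Set.ncard_image_of_injective _ hinj]
    at h1
  exact h1

/-! ## The formal mating -/

open CompactifiedPlane MatingSphere

section Mating

variable {d : ℕ} {f₁ f₂ : ℂ[X]}

theorem formalMating_half (b : Bool) (x : CompactifiedPlane) :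
    formalMating d f₁ f₂ (half b x) = half b (extend d (bif b then f₁ else f₂) x) := by
  cases b <;> rfl

theorem formalMating_inf (θ : UnitAddCircle) :
    formalMating d f₁ f₂ (half true (inf θ)) = half true (inf (d • θ)) := rfl

theorem formalMating_fin (b : Bool) (z : ℂ) :
    formalMating d f₁ f₂ (half b (fin z)) = half b (fin ((bif b then f₁ else f₂).eval z)) :=
  formalMating_half b _

theorem formalMating_iterate_fin (b : Bool) (n : ℕ) (z : ℂ) :
    (formalMating d f₁ f₂)^[n] (half b (fin z)) =
      half b (fin ((fun z => (bif b then f₁ else f₂).eval z)^[n] z)) := by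
  induction n generalizing z with
  | zero => rfl
  | succ n ih => rw [Function.iterate_succ_apply, formalMating_fin, ih, Function.iterate_succ_apply]

theorem formalMating_iterate_inf (n : ℕ) (θ : UnitAddCircle) :
    (formalMating d f₁ f₂)^[n] (half true (inf θ)) = half true (inf (d ^ n • θ)) := by
  induction n generalizing θ with
  | zero => rw [pow_zero, one_smul]; rfl
  | succ n ih => rw [Function.iterate_succ_apply, formalMating_inf, ih, pow_succ, mul_smul]

theorem continuous_formalMating (hd : d ≠ 0) (hm₁ : f₁.Monic) (hm₂ : f₂.Monic)
    (hd₁ : f₁.natDegree = d) (hd₂ : f₂.natDegree = d) : Continuous (formalMating d f₁ f₂) :=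
  continuous_quot_lift _ (continuous_quot_mk.comp
    ((continuous_extend hm₁ hd₁ hd).sumMap (continuous_extend hm₂ hd₂ hd)))

/-! ### Critical points, post-critical set and fibres of the formal mating. -/

theorem inf_notMem_criticalPoints (hd : d ≠ 0) (hm₁ : f₁.Monic) (hm₂ : f₂.Monic)
    (hd₁ : f₁.natDegree = d) (hd₂ : f₂.natDegree = d) (θ : UnitAddCircle) :
    half true (inf θ) ∉ criticalPoints (formalMating d f₁ f₂) := by
  obtain ⟨T₁, hT₁, hinj₁⟩ := exists_injOn_extend hm₁ hd₁ hd θ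
  obtain ⟨T₂, hT₂, hinj₂⟩ := exists_injOn_extend hm₂ hd₂ hd (-θ)
  intro hcrit
  -- One neighbourhood must serve both halves. In the second half `toSpace` conjugates the disc
  -- coordinate, hence the conjugate of `T₂`.
  let U : Set MatingSphere := {s | (toSpace s).1 ∈ T₁ ∩ (starRingEnd ℂ) ⁻¹' T₂}
  have hU₁ : ∀ x, half true x ∈ U → x ∈ toDisc ⁻¹' T₁ := fun x hx => hx.1
  have hU₂ : ∀ x, half false x ∈ U → x ∈ toDisc ⁻¹' T₂ := fun x hx => by
    have := hx.2
    rw [toSpace_half_false, Set.mem_preimage, Complex.conj_conj] at this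
    exact this
  refine hcrit U ?_ ?_
  · have h1 : T₁ ∩ (starRingEnd ℂ) ⁻¹' T₂ ∈ 𝓝 (AddCircle.toCircle θ : ℂ) := by
      refine Filter.inter_mem hT₁ (Complex.continuous_conj.continuousAt.preimage_mem_nhds ?_)
      rwa [← Circle.coe_inv_eq_conj, ← AddCircle.toCircle_neg]
    exact (continuous_fst.comp continuous_toSpace).continuousAt.preimage_mem_nhds h1
  · have hinj : ∀ (b : Bool) (x y : CompactifiedPlane), half b x ∈ U → half b y ∈ U →
        formalMating d f₁ f₂ (half b x) = formalMating d f₁ f₂ (half b y) → x = y := by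
      intro b x y hx hy h
      rw [formalMating_half, formalMating_half] at h
      cases b
      · exact hinj₂ (hU₂ x hx) (hU₂ y hy) (half_injective _ h)
      · exact hinj₁ (hU₁ x hx) (hU₁ y hy) (half_injective _ h)
    intro s hs t ht h
    -- Each open plane and the equator are mapped to themselves, so points with the same image lie
    -- in one closed half, where injectivity is known.
    rcases eq_fin_or_inf s with ⟨b, z, rfl⟩ | ⟨η, rfl⟩ <;>
      rcases eq_fin_or_inf t with ⟨c, w, rfl⟩ | ⟨ζ, rfl⟩
    · have hbc : b = c := by
        rw [formalMating_fin, formalMating_fin] at h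
        exact (half_fin_eq_iff.1 h).1
      subst hbc
      rw [hinj b _ _ hs ht h]
    · rw [formalMating_fin, formalMating_inf] at h
      exact absurd h (half_fin_ne_inf _ _ _)
    · rw [formalMating_fin, formalMating_inf] at h
      exact absurd h.symm (half_fin_ne_inf _ _ _)
    · rw [hinj true _ _ hs ht h]

/-- The planes are open in the sphere, so local injectivity of the mating there is that of the
polynomial. -/
theorem fin_mem_criticalPoints_iff (b : Bool) (c : ℂ) :
    half b (fin c) ∈ criticalPoints (formalMating d f₁ f₂) ↔
      (bif b then f₁ else f₂).derivative.eval c = 0 := by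
  have hemb := isOpenEmbedding_half_fin b
  constructor
  · intro hcrit
    by_contra hc
    obtain ⟨V, hV, hinj⟩ := exists_injOn_of_derivative_eval_ne_zero hc
    refine hcrit ((fun z => half b (fin z)) '' V) (hemb.isOpenMap.image_mem_nhds hV) ?_
    rintro _ ⟨z, hz, rfl⟩ _ ⟨w, hw, rfl⟩ h
    dsimp only at h
    rw [formalMating_fin, formalMating_fin] at h
    dsimp only
    rw [hinj hz hw (half_fin_eq_iff.1 h).2]
  · intro hc U hU hinj
    refine derivative_eval_ne_zero_of_injOn (hemb.continuous.continuousAt.preimage_mem_nhds hU)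
      (fun z hz w hw h => ?_) hc
    refine (half_fin_eq_iff.1 (hinj hz hw ?_)).2
    dsimp only at h
    rw [formalMating_fin, formalMating_fin, h]

/-- The post-critical set of a polynomial. -/
def Polynomial.postcritical (p : ℂ[X]) : Set ℂ :=
  {y : ℂ | ∃ c : ℂ, p.derivative.eval c = 0 ∧ ∃ n : ℕ, 1 ≤ n ∧ (fun z => p.eval z)^[n] c = y}

theorem fin_mem_postcriticalSet_iff (hd : d ≠ 0) (hm₁ : f₁.Monic) (hm₂ : f₂.Monic)
    (hd₁ : f₁.natDegree = d) (hd₂ : f₂.natDegree = d) (b : Bool) (z : ℂ) :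
    half b (fin z) ∈ postcriticalSet (formalMating d f₁ f₂) ↔
      z ∈ (bif b then f₁ else f₂).postcritical := by
  constructor
  · rintro ⟨s, hs, n, hn, h⟩
    rcases eq_fin_or_inf s with ⟨c, w, rfl⟩ | ⟨η, rfl⟩
    · rw [formalMating_iterate_fin] at h
      obtain ⟨rfl, h2⟩ := half_fin_eq_iff.1 h
      exact ⟨w, (fin_mem_criticalPoints_iff _ _).1 hs, n, hn, h2⟩
    · exact absurd hs (inf_notMem_criticalPoints hd hm₁ hm₂ hd₁ hd₂ η)
  · rintro ⟨c, hc, n, hn, rfl⟩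
    exact ⟨_, (fin_mem_criticalPoints_iff _ _).2 hc, n, hn, formalMating_iterate_fin b n c⟩

theorem inf_notMem_postcriticalSet (hd : d ≠ 0) (hm₁ : f₁.Monic) (hm₂ : f₂.Monic)
    (hd₁ : f₁.natDegree = d) (hd₂ : f₂.natDegree = d) (θ : UnitAddCircle) :
    half true (inf θ) ∉ postcriticalSet (formalMating d f₁ f₂) := by
  rintro ⟨s, hs, n, hn, h⟩
  rcases eq_fin_or_inf s with ⟨c, w, rfl⟩ | ⟨η, rfl⟩
  · rw [formalMating_iterate_fin] at h
    exact half_fin_ne_inf _ _ _ h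
  · exact inf_notMem_criticalPoints hd hm₁ hm₂ hd₁ hd₂ η hs

theorem apply_mem_postcriticalSet {X : Type*} [TopologicalSpace X] {f : X → X} {x : X}
    (hx : x ∈ postcriticalSet f) : f x ∈ postcriticalSet f := by
  obtain ⟨c, hc, n, hn, rfl⟩ := hx
  exact ⟨c, hc, n + 1, Nat.le_add_left 1 n, Function.iterate_succ_apply' f n c⟩

theorem apply_mem_postcriticalSet_of_mem_criticalPoints {X : Type*} [TopologicalSpace X] {f : X → X}
    {x : X} (hx : x ∈ criticalPoints f) : f x ∈ postcriticalSet f := ⟨x, hx, 1, le_rfl, rfl⟩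

theorem finite_postcriticalSet_formalMating (hd : d ≠ 0) (hm₁ : f₁.Monic) (hm₂ : f₂.Monic)
    (hd₁ : f₁.natDegree = d) (hd₂ : f₂.natDegree = d) (hf₁ : PostcriticallyFinite f₁)
    (hf₂ : PostcriticallyFinite f₂) : (postcriticalSet (formalMating d f₁ f₂)).Finite := by
  have hf : ∀ b : Bool, (bif b then f₁ else f₂).postcritical.Finite := by
    intro b
    cases b
    · exact hf₂
    · exact hf₁
  refine (Set.finite_iUnion fun b : Bool => (hf b).image fun z => half b (fin z)).subset ?_
  intro s hs
  rcases eq_fin_or_inf s with ⟨b, z, rfl⟩ | ⟨η, rfl⟩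
  · exact Set.mem_iUnion.2
      ⟨b, z, (fin_mem_postcriticalSet_iff hd hm₁ hm₂ hd₁ hd₂ b z).1 hs, rfl⟩
  · exact absurd hs (inf_notMem_postcriticalSet hd hm₁ hm₂ hd₁ hd₂ η)

/-- A fibre stays in the plane, or the equator, of its base point. Over a plane point that is not a
critical value all roots are simple. -/
theorem ncard_fibre_formalMating (hd : d ≠ 0) (hd₁ : f₁.natDegree = d) (hd₂ : f₂.natDegree = d)
    {y : MatingSphere} (hy : y ∉ postcriticalSet (formalMating d f₁ f₂)) :
    (formalMating d f₁ f₂ ⁻¹' {y}).Finite ∧ (formalMating d f₁ f₂ ⁻¹' {y}).ncard = d := by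
  rcases eq_fin_or_inf y with ⟨b, w, rfl⟩ | ⟨θ, rfl⟩
  · have hdeg : (bif b then f₁ else f₂).natDegree = d := by cases b <;> assumption
    have h1 := (bif b then f₁ else f₂).ncard_fibre_of_derivative_ne_zero (by rwa [hdeg]) w
      fun z hz h0 => hy (by
        rw [← hz, ← formalMating_fin (d := d)]
        exact apply_mem_postcriticalSet_of_mem_criticalPoints
          ((fin_mem_criticalPoints_iff b z).2 h0))
    have hset : formalMating d f₁ f₂ ⁻¹' {half b (fin w)} =
        (fun z => half b (fin z)) '' {z | (bif b then f₁ else f₂).eval z = w} := by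
      ext s
      constructor
      · intro hs
        replace hs : formalMating d f₁ f₂ s = half b (fin w) := hs
        rcases eq_fin_or_inf s with ⟨c, z, rfl⟩ | ⟨η, rfl⟩
        · rw [formalMating_fin] at hs
          obtain ⟨rfl, h2⟩ := half_fin_eq_iff.1 hs
          exact ⟨z, h2, rfl⟩
        · exact absurd hs.symm (half_fin_ne_inf _ _ _)
      · rintro ⟨z, rfl, rfl⟩
        exact formalMating_fin b z
    rw [hset, Set.ncard_image_of_injective _ (isOpenEmbedding_half_fin b).injective, h1.2, hdeg]
    exact ⟨h1.1.image _, rfl⟩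
  · have h1 := ncard_nsmul_eq hd θ
    have hinj : Function.Injective fun η => half true (inf η) := fun η ζ h => by
      have := half_injective true h
      injection this
    have hset : formalMating d f₁ f₂ ⁻¹' {half true (inf θ)} =
        (fun η => half true (inf η)) '' {η | d • η = θ} := by
      ext s
      constructor
      · intro hs
        replace hs : formalMating d f₁ f₂ s = half true (inf θ) := hs
        rcases eq_fin_or_inf s with ⟨c, z, rfl⟩ | ⟨η, rfl⟩
        · rw [formalMating_fin] at hs
          exact absurd hs (half_fin_ne_inf _ _ _)
        · exact ⟨η, hinj hs, rfl⟩
      · rintro ⟨η, rfl, rfl⟩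
        rfl
    rw [hset, Set.ncard_image_of_injective _ hinj, h1.2]
    exact ⟨h1.1.image _, rfl⟩

/-- Every point is joined to angle zero at infinity: along the equator, or through the plane minus a
finite set to a far real point `R`, and from there inside a cap of the disc that lies beyond all
post-critical points. -/
theorem isPathConnected_compl_postcriticalSet (hd : d ≠ 0) (hm₁ : f₁.Monic) (hm₂ : f₂.Monic)
    (hd₁ : f₁.natDegree = d) (hd₂ : f₂.natDegree = d) (hf₁ : PostcriticallyFinite f₁)
    (hf₂ : PostcriticallyFinite f₂) :
    IsPathConnected (postcriticalSet (formalMating d f₁ f₂))ᶜ := by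
  have hinf := inf_notMem_postcriticalSet hd hm₁ hm₂ hd₁ hd₂
  have hfin := fin_mem_postcriticalSet_iff hd hm₁ hm₂ hd₁ hd₂
  have hequator : IsPathConnected (Set.range fun θ => half true (inf θ)) :=
    isPathConnected_range ((continuous_half true).comp continuous_inf)
  have hequator_sub : (Set.range fun θ => half true (inf θ)) ⊆
      (postcriticalSet (formalMating d f₁ f₂))ᶜ := by
    rintro _ ⟨θ, rfl⟩
    exact hinf θ
  refine ⟨half true (inf 0), hinf 0, fun {s} hs => ?_⟩
  rcases eq_fin_or_inf s with ⟨b, z, rfl⟩ | ⟨θ, rfl⟩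
  swap
  · exact (hequator.joinedIn _ ⟨0, rfl⟩ _ ⟨θ, rfl⟩).mono hequator_sub
  have hf : (bif b then f₁ else f₂).postcritical.Finite := by
    cases b
    · exact hf₂
    · exact hf₁
  obtain ⟨R, hR0, hR⟩ := hf.isBounded.exists_pos_norm_lt
  -- This is the disc coordinate of `R`, so a plane point of the cap `r ≤ u.re` has modulus at least
  -- `R`.
  let r : ℝ := 1 - (1 + R)⁻¹
  have hr1 : r ≤ 1 := sub_le_self _ (by positivity)
  have hr0 : 0 ≤ r := sub_nonneg.2 (inv_le_one_of_one_le₀ (by linarith))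
  -- the plane without the post-critical set
  have hplane : IsPathConnected
      ((fun z => half b (fin z)) '' ((bif b then f₁ else f₂).postcritical)ᶜ) :=
    (hf.countable.isPathConnected_compl_of_one_lt_rank (E := ℂ)
      (by rw [Complex.rank_real_complex]; norm_num)).image (isOpenEmbedding_half_fin b).continuous
  have hplane_sub : ((fun z => half b (fin z)) '' ((bif b then f₁ else f₂).postcritical)ᶜ) ⊆
      (postcriticalSet (formalMating d f₁ f₂))ᶜ := by
    rintro _ ⟨w, hw, rfl⟩ h
    exact hw ((hfin b w).1 h)
  -- a cap of the closed disc
  have hcap : IsPathConnected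
      (half b '' (toDisc ⁻¹' (Metric.closedBall 0 1 ∩ {u : ℂ | r ≤ u.re}))) := by
    refine (isPathConnected_preimage_toDisc Set.inter_subset_left ?_).image (continuous_half b)
    refine ((convex_closedBall (0 : ℂ) 1).inter (convex_halfSpace_re_ge r)).isPathConnected ⟨1, ?_⟩
    simpa using hr1
  have hcap_sub : (half b '' (toDisc ⁻¹' (Metric.closedBall 0 1 ∩ {u : ℂ | r ≤ u.re}))) ⊆
      (postcriticalSet (formalMating d f₁ f₂))ᶜ := by
    rintro _ ⟨w | θ, ⟨-, hw⟩, rfl⟩ h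
    · have h1 : r ≤ ‖toDisc (fin w)‖ := le_trans hw (Complex.re_le_norm _)
      rw [norm_toDisc_fin, sub_le_sub_iff_left, inv_le_inv₀ (by positivity) (by positivity)] at h1
      have h2 := hR w ((hfin b w).1 h)
      linarith
    · cases b
      · rw [half_false_inf] at h
        exact hinf _ h
      · exact hinf _ h
  have hRmem : (R : ℂ) ∉ (bif b then f₁ else f₂).postcritical := fun h => by
    have := hR _ h
    rw [Complex.norm_real, Real.norm_of_nonneg hR0.le] at this
    exact lt_irrefl _ this
  have h1 : JoinedIn (postcriticalSet (formalMating d f₁ f₂))ᶜ (half b (fin R))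
      (half b (fin z)) :=
    (hplane.joinedIn _ ⟨R, hRmem, rfl⟩ _ ⟨z, fun h => hs ((hfin b z).2 h), rfl⟩).mono hplane_sub
  have h0 : toDisc (inf 0) = 1 := by
    rw [toDisc_inf, AddCircle.toCircle_zero, Circle.coe_one]
  have h2 : JoinedIn (postcriticalSet (formalMating d f₁ f₂))ᶜ (half b (inf 0))
      (half b (fin R)) := by
    refine (hcap.joinedIn _ ⟨inf 0, ⟨?_, ?_⟩, rfl⟩ _ ⟨fin R, ⟨?_, ?_⟩, rfl⟩).mono hcap_sub
    · exact mem_closedBall_zero_iff.2 (norm_toDisc_le _)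
    · rw [h0]
      exact hr1
    · exact mem_closedBall_zero_iff.2 (norm_toDisc_le _)
    · change r ≤ (toDisc (fin R)).re
      have h3 : toDisc (fin R) = ((R / (1 + R) : ℝ) : ℂ) := by
        rw [toDisc_fin, Complex.norm_real, Real.norm_of_nonneg hR0.le, Complex.ofReal_div]
      rw [h3, Complex.ofReal_re]
      apply le_of_eq
      simp only [r]
      field_simp
      ring
  have h3 : half b (inf 0) = half true (inf 0) := by
    cases b
    · rw [half_false_inf, neg_zero]
    · rfl
  rw [h3] at h2
  exact h2.trans h1

/-- The formal mating of two post-critically finite polynomials of degree `d` induces a partial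
self-covering of degree `d`. -/
theorem isPartialSelfCovering_formalMating (hd : 2 ≤ d) (hm₁ : f₁.Monic) (hm₂ : f₂.Monic)
    (hd₁ : f₁.natDegree = d) (hd₂ : f₂.natDegree = d) (hf₁ : PostcriticallyFinite f₁)
    (hf₂ : PostcriticallyFinite f₂) :
    IsPartialSelfCovering (formalMating d f₁ f₂) (postcriticalSet (formalMating d f₁ f₂))ᶜ d := by
  have hd0 : d ≠ 0 := by omega
  have hopen : IsOpen (postcriticalSet (formalMating d f₁ f₂))ᶜ :=
    (finite_postcriticalSet_formalMating hd0 hm₁ hm₂ hd₁ hd₂ hf₁ hf₂).isClosed.isOpen_compl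
  have hdeg : ∀ y ∈ (postcriticalSet (formalMating d f₁ f₂))ᶜ,
      (formalMating d f₁ f₂ ⁻¹' {y}).Finite ∧ (formalMating d f₁ f₂ ⁻¹' {y}).ncard = d :=
    fun y hy => ncard_fibre_formalMating hd0 hd₁ hd₂ hy
  refine ⟨hd, isPathConnected_iff_pathConnectedSpace.1
      (isPathConnected_compl_postcriticalSet hd0 hm₁ hm₂ hd₁ hd₂ hf₁ hf₂),
    hopen.locallyPathConnectedSpace, fun x hx h => hx (apply_mem_postcriticalSet h), ?_, hdeg⟩
  refine (isCoveringMapOn_of_ncard_fibre (continuous_formalMating hd0 hm₁ hm₂ hd₁ hd₂) hopen hdeg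
    fun x hx => ?_).isCoveringMap_restrictPreimage
  by_contra h
  push Not at h
  exact hx (apply_mem_postcriticalSet_of_mem_criticalPoints h)

end Mating

/-! ## The dynamics on the equator -/

theorem equator_eq_iff {a b : ℝ} : equator a = equator b ↔ (a : UnitAddCircle) = b := by
  refine ⟨fun h => ?_, fun h => congrArg (fun θ => half true (inf θ)) h⟩
  have := half_injective true h
  injection this

theorem continuous_equator : Continuous equator :=
  (continuous_half true).comp (continuous_inf.comp (AddCircle.continuous_mk' 1))

section Equator

variable {d : ℕ} {f₁ f₂ : ℂ[X]} {M : Set MatingSphere}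

theorem formalMating_iterate_equator (n : ℕ) (a : ℝ) :
    (formalMating d f₁ f₂)^[n] (equator a) = equator (d ^ n * a) := by
  refine (formalMating_iterate_inf n _).trans (congrArg (fun θ => half true (inf θ)) ?_)
  rw [← AddCircle.coe_nsmul, nsmul_eq_mul, Nat.cast_pow]

/-- The lift is `s ↦ equator (α + s * (c / d^n))`: the iterate multiplies angles by `d^n`, and `d^n
α` is an integer because `x` lies above angle zero. -/
theorem liftEnd_equator (h : IsPartialSelfCovering (formalMating d f₁ f₂) M d)
    (hM : ∀ a, equator a ∈ M) {a b : M} (γ : Path a b) {c : ℝ}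
    (hγ : ∀ s, (γ s : MatingSphere) = equator (s * c)) {n : ℕ}
    (x : Fibre (formalMating d f₁ f₂) n (a : MatingSphere)) {α : ℝ}
    (hx : (x : MatingSphere) = equator α) :
    (h.liftEnd n γ x : MatingSphere) = equator (α + c / d ^ n) := by
  have hd : (d : ℝ) ^ n ≠ 0 := pow_ne_zero _ (Nat.cast_ne_zero.2 (by have := h.two_le; omega))
  have h0 : ((d ^ n * α : ℝ) : UnitAddCircle) = 0 := by
    have h1 := x.2
    rw [hx, formalMating_iterate_equator, ← γ.source, hγ, equator_eq_iff] at h1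
    simpa using h1
  let Γ : C(I, M) := ⟨fun s => ⟨equator (α + s * (c / d ^ n)), hM _⟩,
    (continuous_equator.comp (by fun_prop)).subtype_mk _⟩
  rw [h.liftEnd_eq n γ x (Γ := Γ)]
  · change equator (α + ((1 : I) : ℝ) * (c / d ^ n)) = _
    rw [Set.Icc.coe_one, one_mul]
  · change equator (α + ((0 : I) : ℝ) * (c / d ^ n)) = _
    rw [Set.Icc.coe_zero, zero_mul, add_zero, hx]
  · intro s
    change (formalMating d f₁ f₂)^[n] (equator (α + s * (c / d ^ n))) = _
    rw [hγ, formalMating_iterate_equator, equator_eq_iff, mul_add, AddCircle.coe_add, h0, zero_add]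
    congr 1
    field_simp

/-! ### Angles of words and the adding machine. -/

/-- The angle of the point of the equator labeled by a word. -/
noncomputable def wordAngle {d : ℕ} : List (Fin d) → ℝ
  | [] => 0
  | ε :: w => wordAngle w + (ε : ℝ) / d / d ^ w.length

theorem exists_wordAngle_eq (w : List (Fin d)) : ∃ k : ℕ, wordAngle w = k / d ^ w.length := by
  induction w with
  | nil => exact ⟨0, by simp [wordAngle]⟩
  | cons ε w ih =>
    obtain ⟨k, hk⟩ := ih
    have hd : (d : ℝ) ≠ 0 := Nat.cast_ne_zero.2 (by have := ε.pos; omega)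
    refine ⟨k * d + ε, ?_⟩
    rw [wordAngle, hk, List.length_cons]
    push_cast
    field_simp
    ring

theorem val_finRotate_of_eq {ε : Fin d} (h : (ε : ℕ) + 1 = d) : (finRotate d ε : ℕ) = 0 := by
  obtain _ | m := d
  · exact ε.elim0
  · rw [coe_finRotate, if_pos (Fin.ext (Nat.succ_injective h))]

theorem val_finRotate_of_ne {ε : Fin d} (h : (ε : ℕ) + 1 ≠ d) :
    (finRotate d ε : ℕ) = ε + 1 := by
  obtain _ | m := d
  · exact ε.elim0
  · rw [coe_finRotate, if_neg fun h' => h (by rw [h']; rfl)]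

/-- On a word of length `n` the first letter weighs `1/d^n`. With a carry it drops by `d - 1`, while
the tail gains `1/d^(n-1)`; the net change is again `1/d^n`. -/
theorem coe_wordAngle_addOne (w : List (Fin d)) : (wordAngle (addOne d w) : UnitAddCircle) =
    ((wordAngle w + 1 / d ^ w.length : ℝ) : UnitAddCircle) := by
  induction w with
  -- The empty word absorbs the last carry: `1/d^0` is a full turn.
  | nil => simp [addOne, wordAngle, AddCircle.coe_period]
  | cons ε w ih =>
    have hd : (d : ℝ) ≠ 0 := Nat.cast_ne_zero.2 (by have := ε.pos; omega)
    by_cases h : (ε : ℕ) + 1 = d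
    · rw [addOne, if_pos h, wordAngle, val_finRotate_of_eq h, Nat.cast_zero, zero_div, zero_div,
        add_zero, ih, wordAngle, List.length_cons]
      congr 1
      rw [add_assoc]
      congr 1
      have h1 : (ε : ℝ) + 1 = d := by exact_mod_cast h
      rw [eq_sub_of_add_eq h1]
      field_simp
      ring
    · rw [addOne, if_neg h, wordAngle, val_finRotate_of_ne h, wordAngle, List.length_cons]
      congr 1
      push_cast
      field_simp
      ring

/-- Prepending `ε` lifts an arc of length `ε/d` under the iterate of order `w.length`, which divides
its length by `d^w.length`. -/
theorem label_equator {h : IsPartialSelfCovering (formalMating d f₁ f₂) M d}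
    (hM : ∀ a, equator a ∈ M) {t : M} (ht : (t : MatingSphere) = equator 0)
    (L : LabelingChoice h t)
    (hL : ∀ (ε : Fin d) (s : I), (L.path ε s : MatingSphere) = equator (s * ((ε : ℝ) / d)))
    (w : List (Fin d)) : ((L.label w).2 : MatingSphere) = equator (wordAngle w) := by
  induction w with
  | nil => exact ht
  | cons ε w ih =>
    rw [L.label_cons_snd, h.liftVertex_snd, liftEnd_equator h hM _ (hL ε) _ ih]
    rfl

theorem isMonodromyOfClass_addingMachine
    {h : IsPartialSelfCovering (formalMating d f₁ f₂) M d} (hM : ∀ a, equator a ∈ M) {t : M}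
    (ht : (t : MatingSphere) = equator 0) (L : LabelingChoice h t)
    (hL : ∀ (ε : Fin d) (s : I), (L.path ε s : MatingSphere) = equator (s * ((ε : ℝ) / d)))
    (γ : Path t t) (hγ : ∀ s, (γ s : MatingSphere) = equator s) :
    L.IsMonodromyOfClass (FundamentalGroup.fromPath (Path.Homotopic.Quotient.mk γ))
      (addingMachine d) := by
  intro w
  rw [h.monodromy_mk_apply]
  refine PreimageVertex.ext (length_addOne d w) ?_
  rw [h.liftVertex_snd, liftEnd_equator h hM γ (c := 1) (fun s => by rw [hγ, mul_one]) _
    (label_equator hM ht L hL w), label_equator hM ht L hL, equator_eq_iff]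
  exact coe_wordAngle_addOne w

/-- From angle zero, `j` turns of the loop lead to `j/d^n`. Every vertex of level `n` has a label,
hence an angle `k/d^n`, and so lies in that orbit. -/
theorem actsAsCycle_monodromy_equator
    {h : IsPartialSelfCovering (formalMating d f₁ f₂) M d} (hM : ∀ a, equator a ∈ M) {t : M}
    (ht : (t : MatingSphere) = equator 0) (L : LabelingChoice h t)
    (hL : ∀ (ε : Fin d) (s : I), (L.path ε s : MatingSphere) = equator (s * ((ε : ℝ) / d)))
    (γ : Path t t) (hγ : ∀ s, (γ s : MatingSphere) = equator s) (n : ℕ) :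
    ActsAsCycle (h.monodromy t (FundamentalGroup.fromPath
      (Path.Homotopic.Quotient.mk γ))).1.toEquiv {v | v.1 = n} (d ^ n) := by
  let g : Equiv.Perm (PreimageVertex (formalMating d f₁ f₂) (t : MatingSphere)) :=
    (h.monodromy t (FundamentalGroup.fromPath (Path.Homotopic.Quotient.mk γ))).1.toEquiv
  change ActsAsCycle g _ _
  have hg1 : ∀ v, (g v).1 = v.1 := fun v => rfl
  refine ⟨L.finite_level n, L.ncard_level n, ⟨fun v hv => hv, g.injective.injOn, fun v hv => ?_⟩, ?_⟩
  · refine ⟨g.symm v, ?_, g.apply_symm_apply v⟩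
    change (g.symm v).1 = n
    rw [← hg1, g.apply_symm_apply]
    exact hv
  let v₀ : PreimageVertex (formalMating d f₁ f₂) (t : MatingSphere) :=
    ⟨n, equator 0, by rw [formalMating_iterate_equator, mul_zero, ht]⟩
  have hpow : ∀ j : ℕ, ((g ^ j) v₀).1 = n ∧
      (((g ^ j) v₀).2 : MatingSphere) = equator (j / d ^ n) := by
    intro j
    induction j with
    | zero => exact ⟨rfl, by rw [Nat.cast_zero, zero_div]; rfl⟩
    | succ j ih =>
      rw [pow_succ', Equiv.Perm.mul_apply]
      refine ⟨ih.1, ?_⟩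
      have h1 := liftEnd_equator h hM γ (c := 1) (fun s => by rw [hγ, mul_one]) _ ih.2
      rw [show (d : ℝ) ^ ((g ^ j) v₀).1 = d ^ n by rw [ih.1], ← add_div] at h1
      rw [Nat.cast_succ]
      exact h1
  have hcycle : ∀ v, v.1 = n → Equiv.Perm.SameCycle g v₀ v := by
    intro v hv
    obtain ⟨w, rfl⟩ := L.label_surjective v
    obtain ⟨k, hk⟩ := exists_wordAngle_eq w
    refine ⟨k, ?_⟩
    rw [zpow_natCast]
    refine PreimageVertex.ext ((hpow k).1.trans hv.symm) ?_
    rw [(hpow k).2, label_equator hM ht L hL, hk, show w.length = n from hv]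
  exact fun v hv w hw => (hcycle v hv).symm.trans (hcycle w hw)

/-! ### The equatorial loop and labeling. -/

/-- The loop around the equator. -/
noncomputable def equatorLoop (hM : ∀ a, equator a ∈ M) :
    Path (⟨equator 0, hM 0⟩ : M) ⟨equator 0, hM 0⟩ where
  toFun s := ⟨equator s, hM s⟩
  continuous_toFun := (continuous_equator.comp continuous_subtype_val).subtype_mk _
  source' := rfl
  target' := by
    refine Subtype.ext (equator_eq_iff.2 ?_)
    rw [Set.Icc.coe_one, AddCircle.coe_period, AddCircle.coe_zero]

/-- The numbering of the preimages of the point `equator 0`. -/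
noncomputable def equatorPreimages (h : IsPartialSelfCovering (formalMating d f₁ f₂) M d)
    (hM : equator 0 ∈ M) : Fin d ≃ Fibre (formalMating d f₁ f₂) 1 (equator 0) := by
  have hd : (d : ℝ) ≠ 0 := Nat.cast_ne_zero.2 (by have := h.two_le; omega)
  refine Equiv.ofBijective (fun ε => ⟨equator ((ε : ℝ) / d), ?_⟩) ?_
  · rw [formalMating_iterate_equator, pow_one, mul_div_cancel₀ _ hd, equator_eq_iff]
    rw [AddCircle.coe_zero, AddCircle.coe_eq_zero_iff]
    exact ⟨ε, by simp⟩
  · have : Finite (Fibre (formalMating d f₁ f₂) 1 (equator 0)) := (h.degree _ hM).1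
    -- The angles `ε/d` are distinct in `[0, 1)`, and the degree says that there are exactly `d`
    -- preimages.
    refine (Nat.bijective_iff_injective_and_card _).2 ⟨fun ε η hεη => ?_, ?_⟩
    · have h1 := equator_eq_iff.1 (congrArg Subtype.val hεη)
      have hmem : ∀ ζ : Fin d, (ζ : ℝ) / d ∈ Set.Ico (0 : ℝ) (0 + 1) := fun ζ =>
        ⟨by positivity, by
          rw [zero_add, div_lt_one (lt_of_le_of_ne (Nat.cast_nonneg d) hd.symm)]
          exact_mod_cast ζ.2⟩
      rw [AddCircle.coe_eq_coe_iff_of_mem_Ico (hmem ε) (hmem η), div_left_inj' hd] at h1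
      exact Fin.ext (by exact_mod_cast h1)
    · rw [Nat.card_fin]
      exact (h.degree _ hM).2.symm

/-- The labeling choice given by the arcs of the equator. -/
noncomputable def equatorLabeling (h : IsPartialSelfCovering (formalMating d f₁ f₂) M d)
    (hM : ∀ a, equator a ∈ M) : LabelingChoice h (⟨equator 0, hM 0⟩ : M) where
  pt := equatorPreimages h (hM 0)
  path ε :=
    { toFun := fun s => ⟨equator (s * ((ε : ℝ) / d)), hM _⟩
      continuous_toFun := (continuous_equator.comp (by fun_prop)).subtype_mk _
      source' := by rw [Set.Icc.coe_zero, zero_mul]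
      target' := by
        rw [Set.Icc.coe_one, one_mul]
        rfl }

end Equator

theorem mainTheorem4 (d : ℕ) (hd : 2 ≤ d) (f₁ f₂ : Polynomial ℂ)
    (hm₁ : f₁.Monic) (hm₂ : f₂.Monic) (hd₁ : f₁.natDegree = d) (hd₂ : f₂.natDegree = d)
    (hf₁ : PostcriticallyFinite f₁) (hf₂ : PostcriticallyFinite f₂) :
    -- the formal mating induces a partial self-covering of degree `d`
    ∃ h : IsPartialSelfCovering (formalMating d f₁ f₂)
        (postcriticalSet (formalMating d f₁ f₂))ᶜ d,
      -- for every base point, in `Aut(T(p, t))`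
      (∀ t : ((postcriticalSet (formalMating d f₁ f₂))ᶜ : Set MatingSphere),
        ∃ g ∈ h.IMG t, ∀ n : ℕ, 1 ≤ n →
          ActsAsCycle g.1.toEquiv {v | v.1 = n} (d ^ n)) ∧
      -- for every base point and every labeling choice, in `Aut(T_d)`
      (∀ (t : ((postcriticalSet (formalMating d f₁ f₂))ᶜ : Set MatingSphere))
        (L : LabelingChoice h t),
        ∃ g ∈ L.IMG, ∀ n : ℕ, 1 ≤ n →
          ActsAsCycle g.1.toEquiv {w | w.length = n} (d ^ n)) ∧
      -- the loop around the equator gives the adding machine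
      ∃ (t : ((postcriticalSet (formalMating d f₁ f₂))ᶜ : Set MatingSphere)) (γ : Path t t)
        (L : LabelingChoice h t),
        (t : MatingSphere) = equator 0 ∧
        (∀ s : unitInterval, (γ s : MatingSphere) = equator s) ∧
        (∀ ε : Fin d, (L.pt ε : MatingSphere) = equator ((ε : ℝ) / d)) ∧
        (∀ (ε : Fin d) (s : unitInterval),
          (L.path ε s : MatingSphere) = equator ((s : ℝ) * ((ε : ℝ) / d))) ∧
        L.IsMonodromyOfClass
          (FundamentalGroup.fromPath (Path.Homotopic.Quotient.mk γ)) (addingMachine d) ∧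
        addingMachine d ∈ L.IMG ∧
        (∀ n : ℕ, 1 ≤ n →
          ActsAsCycle (addingMachine d).1.toEquiv {w | w.length = n} (d ^ n)) ∧
        ∀ n : ℕ, 1 ≤ n →
          ActsAsCycle (h.monodromy t
            (FundamentalGroup.fromPath (Path.Homotopic.Quotient.mk γ))).1.toEquiv
            {v | v.1 = n} (d ^ n) := by
  have hM : ∀ a, equator a ∈ (postcriticalSet (formalMating d f₁ f₂))ᶜ := fun a =>
    inf_notMem_postcriticalSet (by omega) hm₁ hm₂ hd₁ hd₂ _
  have h := isPartialSelfCovering_formalMating hd hm₁ hm₂ hd₁ hd₂ hf₁ hf₂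
  have hmono := isMonodromyOfClass_addingMachine hM rfl (equatorLabeling h hM) (fun _ _ => rfl)
    (equatorLoop hM) fun _ => rfl
  have hcycle := actsAsCycle_monodromy_equator hM rfl (equatorLabeling h hM) (fun _ _ => rfl)
    (equatorLoop hM) fun _ => rfl
  have hbase := h.exists_actsAsCycle_of_basePoint (equatorLoop hM) fun n _ => hcycle n
  refine ⟨h, fun t => ?_, fun t L => ?_, ⟨equator 0, hM 0⟩, equatorLoop hM, equatorLabeling h hM,
    rfl, fun _ => rfl, fun _ => rfl, fun _ _ => rfl, hmono, ⟨_, hmono⟩,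
    fun n _ => hmono.actsAsCycle_iff.2 (hcycle n), fun n _ => hcycle n⟩
  · obtain ⟨q, hq⟩ := hbase t
    exact ⟨_, ⟨q, rfl⟩, hq⟩
  · obtain ⟨q, hq⟩ := hbase t
    have hL := L.isMonodromyOfClass_monodromyOnWords q
    exact ⟨_, ⟨q, hL⟩, fun n hn => hL.actsAsCycle_iff.2 (hq n hn)⟩
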